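/- Let $k\ge 2$, $3\le r\le 2k$ and $n\ge 712k$ be integers. For a finite simple graph $G$, let $\lambda(G)$ denote the spectral radius of its adjacency matrix, i.e. the maximum modulus of its eigenvalues, and let $\chi(G)$ denote its chromatic number. Let $T_{m,2}$ be the complete bipartite graph on $m$ vertices with parts of sizes $\lfloor m/2\rfloor$ and $\lceil m/2\rceil$, and let $T_{n-r+1,2}\circ K_r$ be the $n$-vertex graph obtained by identifying a vertex of the complete graph $K_r$ with a vertex of the part of size $\lfloor (n-r+1)/2\rfloor$ of $T_{n-r+1,2}$. If $G$ is an $n$-vertex graph that contains no (not necessarily induced) subgraph isomorphic to the cycle $C_{2k+1}$ and satisfies $\chi(G)\ge r$, then $$\lambda(G)\le \lambda(T_{n-r+1,2}\circ K_r),$$ with equality if and only if $G$ is isomorphic to $T_{n-r+1,2}\circ K_r$. -/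

import Mathlib

open scoped ENNReal

/-- The spectral radius of a finite simple graph: the largest modulus of a (complex) eigenvalue of
its adjacency matrix. It is the supremum of the moduli over the finite spectrum, hence it is never
`⊤`. -/
noncomputable def SimpleGraph.adjSpectralRadius {V : Type*} [Fintype V] (G : SimpleGraph V) :
    ℝ≥0∞ := by
  classical
  exact spectralRadius ℂ (G.adjMatrix ℂ)

/-- The graph obtained from the disjoint union of `G` and `H` by identifying the vertex `a` of `G`
with the vertex `b` of `H`. The identified vertex is represented by `a`. -/
def SimpleGraph.identifyVertex {V W : Type*} (G : SimpleGraph V) (a : V)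
    (H : SimpleGraph W) (b : W) : SimpleGraph (V ⊕ {w : W // w ≠ b}) where
  Adj
    | .inl x, .inl y => G.Adj x y
    | .inl x, .inr w => x = a ∧ H.Adj b w
    | .inr w, .inl x => x = a ∧ H.Adj b w
    | .inr w, .inr z => H.Adj w z
  symm := by
    constructor
    rintro (x | w) (y | z) h
    · exact SimpleGraph.Adj.symm (G := G) h
    · exact h
    · exact h
    · exact SimpleGraph.Adj.symm (G := H) h
  loopless := by
    constructor
    rintro (x | w) h
    · exact G.irrefl h
    · exact H.irrefl h

/-- The bipartite Turán graph on `m` vertices: the complete bipartite graph whose left part has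
`⌊m / 2⌋` vertices and whose right part has `⌈m / 2⌉` vertices. -/
abbrev bipartiteTuranGraph (m : ℕ) : SimpleGraph (Fin (m / 2) ⊕ Fin ((m + 1) / 2)) :=
  completeBipartiteGraph (Fin (m / 2)) (Fin ((m + 1) / 2))

/-- The graph on `n` vertices obtained by identifying a vertex of the complete graph on `r`
vertices with a vertex of the smaller (left) part of the bipartite Turán graph on `n - r + 1`
vertices. -/
def turanIdentifyClique (n r : ℕ) (hr : 1 ≤ r) (hn : r < n) :
    SimpleGraph ((Fin ((n - r + 1) / 2) ⊕ Fin ((n - r + 1 + 1) / 2)) ⊕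
      {w : Fin r // w ≠ ⟨0, hr⟩}) :=
  (bipartiteTuranGraph (n - r + 1)).identifyVertex (.inl ⟨0, by omega⟩)
    (SimpleGraph.completeGraph (Fin r)) ⟨0, hr⟩

/-! Everything follows from one implication: if λ(G) is at least the spectral radius of the extremal
graph T, then G is isomorphic to T. The moduli of the entries of an eigenvector belonging to λ =
λ(G) form a nonnegative vector x with λx ≤ Ax, and this inequality is all the argument needs.

Stability. Let u be a vertex where x is maximal. Applying the inequality twice bounds λ² by the
degree sum over N(u). As N(u) contains no path on 2k vertices, few edges lie inside it, and since λ
is about n/2 almost all pairs between N(u) and its complement are edges, with both sides near n/2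
(`exists_isDensePair`). Let A and B consist of the vertices with linearly many neighbours in one
side or the other. Neighbourhoods of such vertices are joined by paths of every short length of the
right parity, so forbidding C_{2k+1} makes A and B disjoint and independent, and bars a vertex from
having neighbours in both (`IsCore`).

Counting the rest. Summing the eigenvector inequality over A and over B and multiplying gives, up to
a small error, 2λ ≤ |A| + |B|. A vertex outside A ∪ B thus costs almost 1 in 2λ: exactly 1 after
rounding if it has at most one neighbour in the core, and at least 7/8 otherwise
(`card_restLow_add_le`). Since 2λ is about n - r + 1, only about r - 1 such vertices can exist.

Colouring. A and B use two colours, so χ(G) ≥ r prevents the rest from being absorbed cheaply into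
that 2-colouring. Together with the count this leaves exactly r - 1 outside vertices, forming a
clique and all attached to one and the same core vertex a (`clique_rest`, `exists_adj_rest_iff`).

Optimisation. Eliminating the clique from the eigenvector inequalities gives λ² ≤ |B|(|A| + κ(λ)),
where 0 < κ < 1 and κ decreases in λ (`sq_le`). T attains the corresponding equation for balanced
parts, so the comparison forces balanced parts and equality, hence every edge between A and B. -/

open Classical in
/-- The number of neighbours of `v` in the finset `S`. -/
noncomputable def SimpleGraph.degreeIn {V : Type*} (G : SimpleGraph V) (v : V) (S : Finset V) : ℕ :=
  (S.filter (G.Adj v)).card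

/-! ### Degrees into a set, and paths in dense graphs. -/

namespace SimpleGraph

variable {V : Type*} {G : SimpleGraph V}

theorem degreeIn_eq_sum (v : V) (S : Finset V) [DecidableRel G.Adj] :
    G.degreeIn v S = ∑ w ∈ S, if G.Adj v w then 1 else 0 := by
  rw [degreeIn, Finset.card_filter]
  exact Finset.sum_congr rfl fun w _ => by congr

theorem degreeIn_mono (v : V) {S T : Finset V} (h : S ⊆ T) : G.degreeIn v S ≤ G.degreeIn v T := by
  classical
  exact Finset.card_le_card (Finset.filter_subset_filter _ h)

theorem degreeIn_le_card (v : V) (S : Finset V) : G.degreeIn v S ≤ S.card := by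
  classical
  exact Finset.card_filter_le _ _

theorem sum_degreeIn_comm (S T : Finset V) :
    ∑ v ∈ S, G.degreeIn v T = ∑ w ∈ T, G.degreeIn w S := by
  classical
  simp only [degreeIn_eq_sum]
  rw [Finset.sum_comm]
  simp only [G.adj_comm]

theorem degreeIn_insert [DecidableEq V] (v w : V) (S : Finset V) (hw : w ∉ S) :
    G.degreeIn v (insert w S) = G.degreeIn v S + G.degreeIn v {w} := by
  classical
  simp only [degreeIn_eq_sum]
  rw [Finset.sum_insert hw, Finset.sum_singleton, add_comm]

theorem degreeIn_union [DecidableEq V] (v : V) {S T : Finset V} (h : Disjoint S T) :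
    G.degreeIn v (S ∪ T) = G.degreeIn v S + G.degreeIn v T := by
  classical
  simp only [degreeIn_eq_sum]
  rw [Finset.sum_union h]

theorem degreeIn_pos_iff {v : V} {S : Finset V} : 0 < G.degreeIn v S ↔ ∃ w ∈ S, G.Adj v w := by
  classical
  simp [degreeIn, Finset.card_pos, Finset.Nonempty]

/-- A graph with average degree larger than `2 * d` on `S` has a nonempty subset of `S` in which
every vertex has more than `d` neighbours. -/
theorem exists_subset_forall_lt_degreeIn (d : ℕ) (S : Finset V)
    (h : 2 * d * S.card < ∑ v ∈ S, G.degreeIn v S) :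
    ∃ T ⊆ S, T.Nonempty ∧ ∀ v ∈ T, d < G.degreeIn v T := by
  classical
  induction S using Finset.strongInduction with
  | H S ih =>
    by_cases hS : ∀ v ∈ S, d < G.degreeIn v S
    · refine ⟨S, subset_rfl, ?_, hS⟩
      rw [Finset.nonempty_iff_ne_empty]
      rintro rfl
      simp at h
    · push Not at hS
      obtain ⟨v, hv, hvd⟩ := hS
      obtain ⟨R, hvR, rfl⟩ : ∃ R, v ∉ R ∧ insert v R = S :=
        ⟨S.erase v, Finset.notMem_erase v S, Finset.insert_erase hv⟩
      have hvv : G.degreeIn v {v} = 0 := by simp [degreeIn_eq_sum]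
      have hsum : ∑ w ∈ R, G.degreeIn w {v} = G.degreeIn v R := by
        rw [sum_degreeIn_comm]
        simp
      have hvR' := degreeIn_insert (G := G) v v R hvR
      rw [Finset.sum_insert hvR, Finset.card_insert_of_notMem hvR,
        Finset.sum_congr rfl (fun w _ => degreeIn_insert w v R hvR), Finset.sum_add_distrib,
        hsum] at h
      -- Deleting a vertex of degree at most `d` lowers the degree sum by at most `2 * d`, so the
      -- hypothesis passes to `R`.
      obtain ⟨T, hT, h1⟩ := ih R (Finset.ssubset_insert hvR) (by nlinarith)
      exact ⟨T, hT.trans (Finset.subset_insert v R), h1⟩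

/-- If every vertex of `S` has more than `d` neighbours in `S`, then every vertex of `S` is the end
of a path in `S` of any length up to `d + 1`. -/
theorem exists_path_of_forall_lt_degreeIn (d : ℕ) (S : Finset V)
    (h : ∀ v ∈ S, d < G.degreeIn v S) (v : V) (hv : v ∈ S) (m : ℕ) (hm : m ≤ d + 1) :
    ∃ u ∈ S, ∃ p : G.Walk u v, p.IsPath ∧ p.length = m ∧ ∀ w ∈ p.support, w ∈ S := by
  classical
  induction m with
  | zero => exact ⟨v, hv, .nil, by simp, by simp, by simpa using hv⟩
  | succ m ih =>
    obtain ⟨u, hu, p, hp, hpl, hpS⟩ := ih (by omega)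
    -- Greedy extension at the free end: the path has only `m ≤ d` vertices besides `u`, while `u`
    -- has more than `d` neighbours in `S`.
    obtain ⟨w, hwS, hw⟩ : ∃ w ∈ S.filter (G.Adj u), w ∉ (p.support.toFinset.erase u) := by
      refine Finset.exists_mem_notMem_of_card_lt_card ?_
      have h1 := h u hu
      have h2 : (p.support.toFinset.erase u).card ≤ m := by
        rw [Finset.card_erase_of_mem (by simp)]
        have := p.support.toFinset_card_le
        rw [Walk.length_support] at this
        omega
      rw [degreeIn] at h1
      convert lt_of_le_of_lt (h2.trans (by omega : m ≤ d)) h1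
    rw [Finset.mem_filter] at hwS
    have hwu : w ∉ p.support := by
      intro hc
      exact hw (by simp [hc, hwS.2.ne'])
    refine ⟨w, hwS.1, .cons hwS.2.symm p, ?_, by simp [hpl], ?_⟩
    · rw [Walk.cons_isPath_iff]
      exact ⟨hp, hwu⟩
    · intro z hz
      rw [Walk.support_cons, List.mem_cons] at hz
      rcases hz with rfl | hz
      · exact hwS.1
      · exact hpS z hz

/-- A dense bipartite graph between disjoint sets `P` and `Q` contains paths of `2 * j` vertices
from `P` to `Q`. -/
theorem exists_path_between (k : ℕ) (P Q : Finset V) (hPQ : Disjoint P Q)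
    (h : 2 * k * (P.card + Q.card) < ∑ v ∈ P, G.degreeIn v Q) (j : ℕ) (hj : 1 ≤ j) (hjk : j ≤ k) :
    ∃ y ∈ P, ∃ x ∈ Q, ∃ p : G.Walk y x, p.IsPath ∧ p.length + 1 = 2 * j ∧
      ∀ w ∈ p.support, w ∈ P ∨ w ∈ Q := by
  classical
  have hdis : ∀ {v}, v ∈ P → v ∉ Q := fun h1 h2 => Finset.disjoint_left.mp hPQ h1 h2
  let H : SimpleGraph V := G.between (P : Set V) (Q : Set V)
  have hHG : H ≤ G := G.between_le
  have hadj : ∀ v w, H.Adj v w ↔ G.Adj v w ∧ (v ∈ P ∧ w ∈ Q ∨ v ∈ Q ∧ w ∈ P) := by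
    intro v w
    simp [H, between_adj]
  have hHP : ∀ v ∈ P, H.degreeIn v (P ∪ Q) = G.degreeIn v Q := by
    intro v hv
    unfold degreeIn
    congr 1
    ext w
    simp only [Finset.mem_filter, Finset.mem_union, hadj]
    constructor
    · rintro ⟨-, h1, h2 | h2⟩
      · exact ⟨h2.2, h1⟩
      · exact absurd h2.1 (hdis hv)
    · rintro ⟨h1, h2⟩
      exact ⟨Or.inr h1, h2, Or.inl ⟨hv, h1⟩⟩
  have hHQ : ∀ v ∈ Q, H.degreeIn v (P ∪ Q) = G.degreeIn v P := by
    intro v hv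
    unfold degreeIn
    congr 1
    ext w
    simp only [Finset.mem_filter, Finset.mem_union, hadj]
    constructor
    · rintro ⟨-, h1, h2 | h2⟩
      · exact absurd hv (hdis h2.1)
      · exact ⟨h2.2, h1⟩
    · rintro ⟨h1, h2⟩
      exact ⟨Or.inl h1, h2, Or.inr ⟨hv, h1⟩⟩
  obtain ⟨T, hTS, ⟨v, hvT⟩, hT⟩ := exists_subset_forall_lt_degreeIn (G := H) (2 * k) (P ∪ Q) (by
    rw [Finset.sum_union hPQ, Finset.sum_congr rfl hHP, Finset.sum_congr rfl hHQ,
      ← sum_degreeIn_comm P Q, Finset.card_union_of_disjoint hPQ]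
    linarith)
  obtain ⟨x, hxT, hxQ⟩ : ∃ x ∈ T, x ∈ Q := by
    rcases Finset.mem_union.mp (hTS hvT) with hv | hv
    · obtain ⟨w, hwT, hw⟩ := degreeIn_pos_iff.mp ((Nat.zero_le _).trans_lt (hT v hvT))
      rw [hadj] at hw
      rcases hw.2 with h2 | h2
      · exact ⟨w, hwT, h2.2⟩
      · exact absurd h2.1 (hdis hv)
    · exact ⟨v, hvT, hv⟩
  -- The length `2 * j - 1` is odd, so in the bipartite graph `H` a path ending in `Q` must start in
  -- `P`.
  obtain ⟨y, hyT, p, hp, hpl, hpT⟩ := exists_path_of_forall_lt_degreeIn (2 * k) T hT x hxT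
    (2 * j - 1) (by omega)
  let c : H.Coloring Bool := Coloring.mk (fun v => decide (v ∈ P)) (by
    intro a b hab
    rw [hadj] at hab
    rcases hab.2 with h2 | h2
    · have : b ∉ P := fun h => hdis h h2.2
      simp [h2.1, this]
    · have : a ∉ P := fun h => hdis h h2.1
      simp [h2.2, this])
  have hodd := c.odd_length_iff_not_congr p
  have hodd' : Odd p.length := by rw [hpl]; exact ⟨j - 1, by omega⟩
  have hyP : y ∈ P := by
    have h1 := hodd.mp hodd'
    have h2 : x ∉ P := fun h => hdis h hxQ
    have e1 : c y = decide (y ∈ P) := rfl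
    have e2 : c x = decide (x ∈ P) := rfl
    rw [e1, e2] at h1
    simpa [h2] using h1
  refine ⟨y, hyP, x, hxQ, p.mapLe hHG, (Walk.isPath_mapLe hHG).mpr hp, by simp; omega, ?_⟩
  intro w hw
  rw [Walk.support_mapLe_eq_support] at hw
  exact Finset.mem_union.mp (hTS (hpT w hw))

/-- In a graph without `C_{2k+1}` the ends of a path of length `2k` are not adjacent. -/
theorem not_adj_of_path_of_cycleGraph_free {k : ℕ} (hk : 1 ≤ k)
    (hfree : (cycleGraph (2 * k + 1)).Free G) {a b : V} (p : G.Walk a b) (hp : p.IsPath)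
    (hl : p.length = 2 * k) : ¬ G.Adj b a := by
  intro hab
  apply hfree
  rw [cycleGraph_isContained_iff (by omega)]
  refine ⟨b, .cons hab p, ?_, by simp [hl]⟩
  rw [Walk.cons_isCycle_iff]
  refine ⟨hp, fun he => ?_⟩
  have := hp.length_eq_one_of_mem_edges (by rwa [Sym2.eq_swap] at he)
  omega

end SimpleGraph

/-! ### From a dense pair to a bipartite core. -/

namespace SimpleGraph

variable {V : Type*} {G : SimpleGraph V}

theorem card_add_degreeIn_le {v : V} {S T : Finset V} (h : S ⊆ T) :
    S.card + G.degreeIn v T ≤ T.card + G.degreeIn v S := by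
  classical
  have h1 := Finset.card_sdiff_add_card_eq_card h
  have h2 := degreeIn_union (G := G) v (Finset.sdiff_disjoint : Disjoint (T \ S) S)
  rw [Finset.sdiff_union_of_subset h] at h2
  have h3 := degreeIn_le_card (G := G) v (T \ S)
  omega

variable [Fintype V]

/-- A partition of the vertex set into two classes of roughly equal size with almost all edges
between them. -/
structure IsDensePair (G : SimpleGraph V) (k : ℕ) (X Y : Finset V) : Prop where
  two_le : 2 ≤ k
  le_card : 712 * k ≤ Fintype.card V
  disjoint : Disjoint X Y
  mem_or_mem : ∀ v, v ∈ X ∨ v ∈ Y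
  card_left_le : (X.card : ℝ) ≤ 0.584 * Fintype.card V
  card_right_le : (Y.card : ℝ) ≤ 0.584 * Fintype.card V
  card_mul_card_le : (X.card * Y.card : ℝ) ≤
    ∑ v ∈ X, (G.degreeIn v Y : ℝ) + 0.0047 * (Fintype.card V : ℝ) ^ 2

open Classical in
/-- The vertices with at least `0.08 n` neighbours in `S`. -/
noncomputable def heavy (G : SimpleGraph V) (S : Finset V) : Finset V :=
  Finset.univ.filter fun v => 0.08 * (Fintype.card V : ℝ) ≤ G.degreeIn v S

theorem mem_heavy {S : Finset V} {v : V} :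
    v ∈ G.heavy S ↔ 0.08 * (Fintype.card V : ℝ) ≤ G.degreeIn v S := by
  simp [heavy]

namespace IsDensePair

variable {k : ℕ} {X Y : Finset V}

theorem symm (h : G.IsDensePair k X Y) : G.IsDensePair k Y X where
  two_le := h.two_le
  le_card := h.le_card
  disjoint := h.disjoint.symm
  mem_or_mem v := (h.mem_or_mem v).symm
  card_left_le := h.card_right_le
  card_right_le := h.card_left_le
  card_mul_card_le := by
    have := h.card_mul_card_le
    have h2 := sum_degreeIn_comm (G := G) X Y
    have h3 : ∑ v ∈ X, (G.degreeIn v Y : ℝ) = ∑ v ∈ Y, (G.degreeIn v X : ℝ) := by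
      exact_mod_cast h2
    linarith

theorem card_add_card (h : G.IsDensePair k X Y) :
    (X.card + Y.card : ℝ) = Fintype.card V := by
  classical
  have : X ∪ Y = Finset.univ := by
    ext v
    simpa using h.mem_or_mem v
  rw [← Finset.card_univ, ← this, Finset.card_union_of_disjoint h.disjoint]
  push_cast
  rfl

theorem le_card_left (h : G.IsDensePair k X Y) :
    0.416 * (Fintype.card V : ℝ) ≤ X.card := by
  linarith [h.card_add_card, h.card_right_le]

theorem cast_le_card (h : G.IsDensePair k X Y) : 712 * (k : ℝ) ≤ Fintype.card V := by
  exact_mod_cast h.le_card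

theorem large (h : G.IsDensePair k X Y) : (1424 : ℝ) ≤ Fintype.card V := by
  have h1 := h.cast_le_card
  have h2 : (2 : ℝ) ≤ k := by exact_mod_cast h.two_le
  linarith

/-- The non-edges between `P` and `Q` are among those between `X` and `Y`, so the same absolute
error serves for all subsets. -/
theorem card_mul_card_le_of_subset (h : G.IsDensePair k X Y) {P Q : Finset V} (hP : P ⊆ X)
    (hQ : Q ⊆ Y) : (P.card * Q.card : ℝ) ≤
      ∑ v ∈ P, (G.degreeIn v Q : ℝ) + 0.0047 * (Fintype.card V : ℝ) ^ 2 := by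
  have h1 : ∑ v ∈ P, ((Q.card : ℝ) - G.degreeIn v Q) ≤
      ∑ v ∈ X, ((Y.card : ℝ) - G.degreeIn v Y) := by
    refine (Finset.sum_le_sum (g := fun v => (Y.card : ℝ) - G.degreeIn v Y) ?_).trans
      (Finset.sum_le_sum_of_subset_of_nonneg hP ?_)
    · intro v _
      have : (Q.card + G.degreeIn v Y : ℝ) ≤ Y.card + G.degreeIn v Q := by
        exact_mod_cast card_add_degreeIn_le hQ
      linarith
    · intro v _ _
      have : (G.degreeIn v Y : ℝ) ≤ Y.card := by exact_mod_cast degreeIn_le_card v Y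
      linarith
  rw [Finset.sum_sub_distrib, Finset.sum_sub_distrib, Finset.sum_const, Finset.sum_const,
    nsmul_eq_mul, nsmul_eq_mul] at h1
  linarith [h.card_mul_card_le]

/-- Few vertices of `X` have few neighbours in `Y`. -/
theorem card_le_of_forall_notMem_heavy (h : G.IsDensePair k X Y) {S : Finset V} (hS : S ⊆ X)
    (hS' : ∀ v ∈ S, v ∉ G.heavy Y) : (S.card : ℝ) ≤ 0.014 * Fintype.card V := by
  have h1 := h.card_mul_card_le_of_subset hS subset_rfl
  have h2 : ∑ v ∈ S, (G.degreeIn v Y : ℝ) ≤ ∑ v ∈ S, 0.08 * (Fintype.card V : ℝ) :=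
    Finset.sum_le_sum fun v hv => by
      have := hS' v hv
      rw [mem_heavy] at this
      linarith
  rw [Finset.sum_const, nsmul_eq_mul] at h2
  have h3 := h.symm.le_card_left
  have h4 := h.large
  by_contra! hc
  have h5 : (S.card : ℝ) * (Y.card - 0.08 * Fintype.card V) ≤
      0.0047 * (Fintype.card V : ℝ) ^ 2 := by
    linarith
  -- Each vertex of `S` misses at least `(0.416 - 0.08) n` of `Y`, and `0.0047 / 0.336 < 0.014`.
  nlinarith

/-- Paths of any even number of vertices between the neighbourhoods of two heavy vertices. -/
theorem exists_path (h : G.IsDensePair k X Y) {a b : V} (ha : a ∈ G.heavy Y) (hb : b ∈ G.heavy X)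
    (F : Finset V) (hF : F.card ≤ 5) (j : ℕ) (hj : 1 ≤ j) (hjk : j ≤ k) :
    ∃ y x, ∃ p : G.Walk y x, p.IsPath ∧ p.length + 1 = 2 * j ∧ G.Adj a y ∧ G.Adj b x ∧
      ∀ w ∈ p.support, w ∉ F := by
  classical
  let P := Y.filter (fun y => G.Adj a y) \ F
  let Q := X.filter (fun x => G.Adj b x) \ F
  have hP : (0.08 * Fintype.card V - 5 : ℝ) ≤ P.card := by
    have h1 := Finset.le_card_sdiff F (Y.filter (fun y => G.Adj a y))
    have h2 : (Y.filter (fun y => G.Adj a y)).card ≤ P.card + 5 := by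
      change _ ≤ (Y.filter (fun y => G.Adj a y) \ F).card + 5
      omega
    have h3 : ((Y.filter (fun y => G.Adj a y)).card : ℝ) ≤ P.card + 5 := by exact_mod_cast h2
    rw [mem_heavy, degreeIn] at ha
    have h4 : 0.08 * (Fintype.card V : ℝ) ≤ (Y.filter (fun y => G.Adj a y)).card := by
      convert ha
    linarith
  have hQ : (0.08 * Fintype.card V - 5 : ℝ) ≤ Q.card := by
    have h1 := Finset.le_card_sdiff F (X.filter (fun y => G.Adj b y))
    have h2 : (X.filter (fun y => G.Adj b y)).card ≤ Q.card + 5 := by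
      change _ ≤ (X.filter (fun y => G.Adj b y) \ F).card + 5
      omega
    have h3 : ((X.filter (fun y => G.Adj b y)).card : ℝ) ≤ Q.card + 5 := by exact_mod_cast h2
    rw [mem_heavy, degreeIn] at hb
    have h4 : 0.08 * (Fintype.card V : ℝ) ≤ (X.filter (fun y => G.Adj b y)).card := by
      convert hb
    linarith
  have hPY : P ⊆ Y := Finset.sdiff_subset.trans (Finset.filter_subset _ _)
  have hQX : Q ⊆ X := Finset.sdiff_subset.trans (Finset.filter_subset _ _)
  have hPQ : Disjoint P Q := Finset.disjoint_of_subset_left hPY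
    (Finset.disjoint_of_subset_right hQX h.disjoint.symm)
  have hdense : 2 * k * (P.card + Q.card) < ∑ v ∈ P, G.degreeIn v Q := by
    have h1 := h.symm.card_mul_card_le_of_subset hPY hQX
    have h2 : (2 * k * (P.card + Q.card) : ℝ) < ∑ v ∈ P, (G.degreeIn v Q : ℝ) := by
      have hN := h.large
      have hk := h.cast_le_card
      have hk0 : (0 : ℝ) ≤ k := k.cast_nonneg
      set N : ℝ := (Fintype.card V : ℝ)
      have e1 : 0.07 * N ≤ (P.card : ℝ) - 2 * k := by linarith
      have e2 : 0.07 * N ≤ (Q.card : ℝ) - 2 * k := by linarith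
      have hp : 0.0764 * N ≤ P.card := by linarith
      have hq : 0.0764 * N ≤ Q.card := by linarith
      -- The density needed is `(|P| - 2k)(|Q| - 2k) > 0.0047 N² + 4k²`. The value 0.0764 is 0.08
      -- less the five vertices of `F`, as `N ≥ 1424`.
      have e3 : (0.0764 * N - 2 * k) * (0.0764 * N - 2 * k) ≤
          ((P.card : ℝ) - 2 * k) * ((Q.card : ℝ) - 2 * k) := by
        apply mul_le_mul <;> linarith
      nlinarith [mul_nonneg (sub_nonneg.mpr hk) (by linarith : (0:ℝ) ≤ N)]
    exact_mod_cast h2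
  obtain ⟨y, hy, x, hx, p, hp, hpl, hps⟩ := exists_path_between k P Q hPQ hdense j hj hjk
  simp only [P, Q, Finset.mem_sdiff, Finset.mem_filter] at hy hx hps
  exact ⟨y, x, p, hp, hpl, hy.1.2, hx.1.2, fun w hw => (hps w hw).elim (·.2) (·.2)⟩

/-- Paths of any odd number of vertices between the neighbourhoods of two heavy vertices of the
same side. -/
theorem exists_path_same (h : G.IsDensePair k X Y) {a a' : V} (ha : a ∈ G.heavy Y)
    (ha' : a' ∈ G.heavy Y) (F : Finset V) (hF : F.card ≤ 4) (j : ℕ) (hj : 1 ≤ j) (hjk : j ≤ k) :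
    ∃ y z, ∃ p : G.Walk y z, p.IsPath ∧ p.length = 2 * j ∧ G.Adj a y ∧ G.Adj a' z ∧
      ∀ w ∈ p.support, w ∉ F := by
  classical
  -- A neighbour `z` of `a'` that is itself heavy towards `X` fixes the parity: join the
  -- neighbourhoods of `a` and `z`, then append `z`. Hence `F` has one element fewer than in
  -- `exists_path`.
  obtain ⟨z, hz, hzF, hzX⟩ : ∃ z, G.Adj a' z ∧ z ∉ F ∧ z ∈ G.heavy X := by
    by_contra! hc
    have h1 := h.symm.card_le_of_forall_notMem_heavy (S := Y.filter (fun y => G.Adj a' y) \ F)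
      (Finset.sdiff_subset.trans (Finset.filter_subset _ _)) (by
        intro v hv
        rw [Finset.mem_sdiff, Finset.mem_filter] at hv
        exact hc v hv.1.2 hv.2)
    have h2 := Finset.le_card_sdiff F (Y.filter (fun y => G.Adj a' y))
    have h3 : (Y.filter (fun y => G.Adj a' y)).card ≤
      (Y.filter (fun y => G.Adj a' y) \ F).card + 4 := by omega
    have h4 : ((Y.filter (fun y => G.Adj a' y)).card : ℝ) ≤
      (Y.filter (fun y => G.Adj a' y) \ F).card + 4 := by exact_mod_cast h3
    have h5 : 0.08 * (Fintype.card V : ℝ) ≤ (Y.filter (fun y => G.Adj a' y)).card := by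
      rw [mem_heavy, degreeIn] at ha'
      convert ha'
    linarith [h.large]
  obtain ⟨y, x, p, hp, hpl, hy, hx, hps⟩ := h.exists_path ha hzX (insert z F)
    ((Finset.card_insert_le _ _).trans (by omega)) j hj hjk
  simp only [Finset.mem_insert, not_or] at hps
  refine ⟨y, z, p.concat hx.symm, ?_, by rw [Walk.length_concat]; exact hpl, hy, hz, ?_⟩
  · rw [Walk.concat_isPath_iff]
    exact ⟨hp, fun hc => (hps z hc).1 rfl⟩
  · intro w hw
    rw [Walk.support_concat, List.mem_append, List.mem_singleton] at hw
    rcases hw with hw | rfl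
    · exact (hps w hw).2
    · exact hzF

/-- A vertex heavy towards both sides closes a path on `2k` vertices between its two neighbourhoods
into a C_{2k+1}. -/
theorem disjoint_heavy (h : G.IsDensePair k X Y) (hfree : (cycleGraph (2 * k + 1)).Free G)
    : Disjoint (G.heavy Y) (G.heavy X) := by
  rw [Finset.disjoint_left]
  intro v hv hv'
  obtain ⟨y, x, p, hp, hpl, hy, hx, hps⟩ := h.exists_path hv hv' {v} (by simp) k
    (by linarith [h.two_le]) le_rfl
  refine not_adj_of_path_of_cycleGraph_free (by linarith [h.two_le]) hfree (.cons hy p) ?_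
    (by simpa using hpl) hx.symm
  rw [Walk.cons_isPath_iff]
  exact ⟨hp, fun hc => hps v hc (by simp)⟩

/-- The edge `a a'` and a path on `2k - 1` further vertices from N(a) to N(a') would form a
C_{2k+1}. -/
theorem not_adj_heavy (h : G.IsDensePair k X Y) (hfree : (cycleGraph (2 * k + 1)).Free G)
    {a a' : V} (ha : a ∈ G.heavy Y) (ha' : a' ∈ G.heavy Y) : ¬ G.Adj a a' := by
  classical
  intro hadj
  have hk := h.two_le
  obtain ⟨y, x, p, hp, hpl, hy, hx, hps⟩ := h.exists_path_same ha ha' {a, a'}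
    (Finset.card_le_two.trans (by omega)) (k - 1) (by omega) (by omega)
  refine not_adj_of_path_of_cycleGraph_free (by omega) hfree (.cons hadj.symm (.cons hy p)) ?_
    (by simp [hpl]; omega) hx.symm
  simp only [Finset.mem_insert, Finset.mem_singleton, not_or] at hps
  rw [Walk.cons_isPath_iff, Walk.cons_isPath_iff, Walk.support_cons, List.mem_cons]
  exact ⟨⟨hp, fun hc => (hps a hc).1 rfl⟩, fun hc => hc.elim hadj.ne' fun hc => (hps a' hc).2 rfl⟩

/-- The path `b w a` would be closed by `2k - 2` further vertices running from N(a) to N(b). -/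
theorem not_adj_heavy_of_adj_heavy (h : G.IsDensePair k X Y)
    (hfree : (cycleGraph (2 * k + 1)).Free G)
    {w a b : V} (ha : a ∈ G.heavy Y) (hb : b ∈ G.heavy X)
    (hwa : G.Adj w a) : ¬ G.Adj w b := by
  classical
  intro hwb
  have hk := h.two_le
  have hab : a ≠ b := fun hc => Finset.disjoint_left.mp (h.disjoint_heavy hfree) ha (hc ▸ hb)
  obtain ⟨y, x, p, hp, hpl, hy, hx, hps⟩ := h.exists_path ha hb {w, a, b}
    (Finset.card_le_three.trans (by omega)) (k - 1) (by omega) (by omega)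
  simp only [Finset.mem_insert, Finset.mem_singleton, not_or] at hps
  refine not_adj_of_path_of_cycleGraph_free (by omega) hfree
    (.cons hwb.symm (.cons hwa (.cons hy p))) ?_ (by simp; omega) hx.symm
  simp only [Walk.cons_isPath_iff, Walk.support_cons, List.mem_cons, not_or]
  exact ⟨⟨⟨hp, fun hc => (hps a hc).2.1 rfl⟩, hwa.ne, fun hc => (hps w hc).1 rfl⟩,
    hwb.ne', hab.symm, fun hc => (hps b hc).2.2 rfl⟩

/-- The path `a' w' w a` needs `2k - 3` further vertices from N(a) to N(a'). For `k = 2` that is a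
single common neighbour, which density does not supply; hence the exception. -/
theorem eq_two_of_ear (h : G.IsDensePair k X Y) (hfree : (cycleGraph (2 * k + 1)).Free G)
    {w w' a a' : V} (ha : a ∈ G.heavy Y) (ha' : a' ∈ G.heavy Y) (hne : a ≠ a')
    (hww : G.Adj w w') (hwa : G.Adj w a) (hwa' : G.Adj w' a') : k = 2 := by
  classical
  have hk := h.two_le
  by_contra hk2
  obtain ⟨y, x, p, hp, hpl, hy, hx, hps⟩ := h.exists_path_same ha ha' {w, w', a, a'}
    Finset.card_le_four (k - 2) (by omega) (by omega)
  simp only [Finset.mem_insert, Finset.mem_singleton, not_or] at hps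
  have h1 : w ≠ a' := fun hc => h.not_adj_heavy hfree ha' ha (hc ▸ hwa)
  have h2 : w' ≠ a := fun hc => h.not_adj_heavy hfree ha ha' (hc ▸ hwa')
  refine not_adj_of_path_of_cycleGraph_free (by omega) hfree
    (.cons hwa'.symm (.cons hww.symm (.cons hwa (.cons hy p)))) ?_ (by simp; omega) hx.symm
  simp only [Walk.cons_isPath_iff, Walk.support_cons, List.mem_cons, not_or]
  exact ⟨⟨⟨⟨hp, fun hc => (hps a hc).2.2.1 rfl⟩, hwa.ne, fun hc => (hps w hc).1 rfl⟩,
    hww.ne', h2, fun hc => (hps w' hc).2.1 rfl⟩, hwa'.ne', h1.symm, hne.symm,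
    fun hc => (hps a' hc).2.2.2 rfl⟩

end IsDensePair

/-- A large bipartite part `A ∪ B` of a graph, such that the few remaining vertices have few
neighbours in it, all on one side, and an edge outside of it does not attach to two different
vertices of the same side, unless `k = 2` and these have no common neighbour. -/
structure IsCore (G : SimpleGraph V) (k : ℕ) (A B : Finset V) : Prop where
  two_le : 2 ≤ k
  le_card : 712 * k ≤ Fintype.card V
  disjoint : Disjoint A B
  not_adj_left : ∀ u ∈ A, ∀ v ∈ A, ¬ G.Adj u v
  not_adj_right : ∀ u ∈ B, ∀ v ∈ B, ¬ G.Adj u v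
  one_side : ∀ w, ∀ a ∈ A, ∀ b ∈ B, G.Adj w a → ¬ G.Adj w b
  ear_left : ∀ w w' a a', w ∉ B → w' ∉ B → a ∈ A → a' ∈ A → a ≠ a' → G.Adj w w' → G.Adj w a →
    G.Adj w' a' → k = 2 ∧ ∀ b ∈ B, G.Adj b a → ¬ G.Adj b a'
  ear_right : ∀ w w' b b', w ∉ A → w' ∉ A → b ∈ B → b' ∈ B → b ≠ b' → G.Adj w w' → G.Adj w b →
    G.Adj w' b' → k = 2 ∧ ∀ a ∈ A, G.Adj a b → ¬ G.Adj a b'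
  card_left_le : (A.card : ℝ) ≤ 0.598 * Fintype.card V
  card_right_le : (B.card : ℝ) ≤ 0.598 * Fintype.card V
  card_le : ∀ Z : Finset V, (∀ w ∈ Z, w ∉ A ∧ w ∉ B) → (Z.card : ℝ) ≤ 0.028 * Fintype.card V
  degreeIn_left_le : ∀ w, w ∉ A → w ∉ B → (G.degreeIn w A : ℝ) ≤ 0.094 * Fintype.card V
  degreeIn_right_le : ∀ w, w ∉ A → w ∉ B → (G.degreeIn w B : ℝ) ≤ 0.094 * Fintype.card V

theorem IsCore.symm {k : ℕ} {A B : Finset V} (h : G.IsCore k A B) : G.IsCore k B A where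
  two_le := h.two_le
  le_card := h.le_card
  disjoint := h.disjoint.symm
  not_adj_left := h.not_adj_right
  not_adj_right := h.not_adj_left
  one_side w b hb a ha h1 h2 := h.one_side w a ha b hb h2 h1
  ear_left := h.ear_right
  ear_right := h.ear_left
  card_left_le := h.card_right_le
  card_right_le := h.card_left_le
  card_le Z hZ := h.card_le Z fun w hw => (hZ w hw).symm
  degreeIn_left_le w h1 h2 := h.degreeIn_right_le w h2 h1
  degreeIn_right_le w h1 h2 := h.degreeIn_left_le w h2 h1

namespace IsDensePair

variable {k : ℕ} {X Y : Finset V}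

/-- In the exceptional case a common neighbour `b` would give the 5-cycle `a w w' a' b`. -/
theorem not_adj_of_ear (h : G.IsDensePair k X Y) (hfree : (cycleGraph (2 * k + 1)).Free G)
    {w w' a a' : V} (hw : w ∉ G.heavy X) (hw' : w' ∉ G.heavy X)
    (ha : a ∈ G.heavy Y) (ha' : a' ∈ G.heavy Y) (hne : a ≠ a')
    (hww : G.Adj w w') (hwa : G.Adj w a) (hwa' : G.Adj w' a') :
    k = 2 ∧ ∀ b ∈ G.heavy X, G.Adj b a → ¬ G.Adj b a' := by
  have hk := h.eq_two_of_ear hfree ha ha' hne hww hwa hwa'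
  refine ⟨hk, fun b hb hba hba' => ?_⟩
  have h1 : w ≠ a' := fun hc => h.not_adj_heavy hfree ha' ha (hc ▸ hwa)
  have h2 : w' ≠ a := fun hc => h.not_adj_heavy hfree ha ha' (hc ▸ hwa')
  refine not_adj_of_path_of_cycleGraph_free (by omega) hfree
    (.cons hba (.cons hwa.symm (.cons hww (.cons hwa' .nil)))) ?_ (by simp [hk]) hba'.symm
  simp only [Walk.cons_isPath_iff, Walk.support_cons, List.mem_cons, not_or, Walk.support_nil,
    Walk.IsPath.nil, List.not_mem_nil, not_false_eq_true, and_true, true_and]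
  exact ⟨⟨⟨hwa'.ne, hww.ne, h1⟩, hwa.ne', h2.symm, hne⟩, hba.ne,
    fun hc => hw (hc ▸ hb), fun hc => hw' (hc ▸ hb), hba'.ne⟩

theorem card_heavy_le (h : G.IsDensePair k X Y) (hfree : (cycleGraph (2 * k + 1)).Free G) :
    ((G.heavy Y).card : ℝ) ≤ 0.598 * Fintype.card V := by
  classical
  have h1 := h.symm.card_le_of_forall_notMem_heavy (S := (G.heavy Y).filter (· ∈ Y))
    (fun v hv => (Finset.mem_filter.mp hv).2)
    (fun v hv => Finset.disjoint_left.mp (h.disjoint_heavy hfree) (Finset.mem_filter.mp hv).1)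
  have h2 : (G.heavy Y).card ≤ X.card + ((G.heavy Y).filter (· ∈ Y)).card := by
    refine (Finset.card_le_card ?_).trans (Finset.card_union_le _ _)
    intro v hv
    rw [Finset.mem_union, Finset.mem_filter]
    exact (h.mem_or_mem v).imp_right fun h' => ⟨hv, h'⟩
  have h3 : ((G.heavy Y).card : ℝ) ≤ X.card + ((G.heavy Y).filter (· ∈ Y)).card := by
    exact_mod_cast h2
  linarith [h.card_left_le]

/-- `G.heavy Y` lies in `X` up to `0.014 n` vertices, and `w` has fewer than `0.08 n` neighbours in
`X`. -/
theorem degreeIn_heavy_le (h : G.IsDensePair k X Y) (hfree : (cycleGraph (2 * k + 1)).Free G)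
    {w : V} (hw : w ∉ G.heavy X) : (G.degreeIn w (G.heavy Y) : ℝ) ≤ 0.094 * Fintype.card V := by
  classical
  have h1 := h.symm.card_le_of_forall_notMem_heavy (S := (G.heavy Y).filter (· ∈ Y))
    (fun v hv => (Finset.mem_filter.mp hv).2)
    (fun v hv => Finset.disjoint_left.mp (h.disjoint_heavy hfree) (Finset.mem_filter.mp hv).1)
  have h2 : G.degreeIn w (G.heavy Y) ≤ G.degreeIn w X + ((G.heavy Y).filter (· ∈ Y)).card := by
    have hdis : Disjoint X ((G.heavy Y).filter (· ∈ Y)) :=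
      Finset.disjoint_of_subset_right (fun v hv => (Finset.mem_filter.mp hv).2) h.disjoint
    have h3 := degreeIn_union (G := G) w hdis
    have h4 := degreeIn_le_card (G := G) w ((G.heavy Y).filter (· ∈ Y))
    refine (degreeIn_mono w (T := X ∪ (G.heavy Y).filter (· ∈ Y)) ?_).trans (by omega)
    intro v hv
    rw [Finset.mem_union, Finset.mem_filter]
    exact (h.mem_or_mem v).imp_right fun h' => ⟨hv, h'⟩
  have h3 : (G.degreeIn w (G.heavy Y) : ℝ) ≤
      G.degreeIn w X + ((G.heavy Y).filter (· ∈ Y)).card := by exact_mod_cast h2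
  rw [mem_heavy] at hw
  linarith

theorem isCore (h : G.IsDensePair k X Y) (hfree : (cycleGraph (2 * k + 1)).Free G) :
    G.IsCore k (G.heavy Y) (G.heavy X) where
  two_le := h.two_le
  le_card := h.le_card
  disjoint := h.disjoint_heavy hfree
  not_adj_left u hu v hv := h.not_adj_heavy hfree hu hv
  not_adj_right u hu v hv := h.symm.not_adj_heavy hfree hu hv
  one_side w a ha b hb hwa := h.not_adj_heavy_of_adj_heavy hfree ha hb hwa
  ear_left w w' a a' h1 h2 h3 h4 h5 h6 h7 h8 := h.not_adj_of_ear hfree h1 h2 h3 h4 h5 h6 h7 h8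
  ear_right w w' a a' h1 h2 h3 h4 h5 h6 h7 h8 :=
    h.symm.not_adj_of_ear hfree h1 h2 h3 h4 h5 h6 h7 h8
  card_left_le := h.card_heavy_le hfree
  card_right_le := h.symm.card_heavy_le hfree
  card_le Z hZ := by
    classical
    have h1 := h.card_le_of_forall_notMem_heavy (S := Z.filter (· ∈ X))
      (fun v hv => (Finset.mem_filter.mp hv).2) (fun v hv => (hZ v (Finset.mem_filter.mp hv).1).1)
    have h2 := h.symm.card_le_of_forall_notMem_heavy (S := Z.filter (· ∈ Y))
      (fun v hv => (Finset.mem_filter.mp hv).2) (fun v hv => (hZ v (Finset.mem_filter.mp hv).1).2)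
    have h3 : Z.card ≤ (Z.filter (· ∈ X)).card + (Z.filter (· ∈ Y)).card := by
      refine (Finset.card_le_card ?_).trans (Finset.card_union_le _ _)
      intro v hv
      rw [Finset.mem_union, Finset.mem_filter, Finset.mem_filter]
      exact (h.mem_or_mem v).imp (fun h' => ⟨hv, h'⟩) (fun h' => ⟨hv, h'⟩)
    have h4 : (Z.card : ℝ) ≤ (Z.filter (· ∈ X)).card + (Z.filter (· ∈ Y)).card := by
      exact_mod_cast h3
    linarith
  degreeIn_left_le w _ h2 := h.degreeIn_heavy_le hfree h2
  degreeIn_right_le w h1 _ := h.symm.degreeIn_heavy_le hfree h1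

end IsDensePair

end SimpleGraph

/-! ### Weighted degrees, subeigenvectors and the spectral stability step. -/

namespace SimpleGraph

variable {V : Type*} {G : SimpleGraph V}

open Classical in
/-- The sum of the weights `x` over the neighbours of `v` in `S`. -/
noncomputable def weightIn (G : SimpleGraph V) (x : V → ℝ) (v : V) (S : Finset V) : ℝ :=
  ∑ w ∈ S.filter (G.Adj v), x w

theorem weightIn_eq_sum (x : V → ℝ) (v : V) (S : Finset V) [DecidableRel G.Adj] :
    G.weightIn x v S = ∑ w ∈ S, if G.Adj v w then x w else 0 := by
  rw [weightIn, Finset.sum_filter]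
  exact Finset.sum_congr rfl fun w _ => by congr

theorem weightIn_union [DecidableEq V] (x : V → ℝ) (v : V) {S T : Finset V} (h : Disjoint S T) :
    G.weightIn x v (S ∪ T) = G.weightIn x v S + G.weightIn x v T := by
  classical
  simp only [weightIn_eq_sum]
  rw [Finset.sum_union h]

theorem weightIn_le_degreeIn_mul {x : V → ℝ} {M : ℝ} (hM : ∀ v, x v ≤ M) (v : V) (S : Finset V) :
    G.weightIn x v S ≤ G.degreeIn v S * M := by
  classical
  rw [weightIn, degreeIn, ← nsmul_eq_mul]
  exact Finset.sum_le_card_nsmul _ _ _ fun w _ => hM w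

theorem weightIn_le_sum {x : V → ℝ} (hx : ∀ v, 0 ≤ x v) (v : V) (S : Finset V) :
    G.weightIn x v S ≤ ∑ w ∈ S, x w := by
  classical
  exact Finset.sum_le_sum_of_subset_of_nonneg (Finset.filter_subset _ _) fun w _ _ => hx w

theorem sum_weightIn_eq (x : V → ℝ) (S T : Finset V) :
    ∑ v ∈ S, G.weightIn x v T = ∑ w ∈ T, G.degreeIn w S * x w := by
  classical
  simp only [weightIn_eq_sum, degreeIn_eq_sum]
  rw [Finset.sum_comm]
  refine Finset.sum_congr rfl fun w _ => ?_
  push_cast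
  rw [Finset.sum_mul]
  exact Finset.sum_congr rfl fun v _ => by simp [G.adj_comm]

theorem weightIn_eq_zero {x : V → ℝ} {v : V} {S : Finset V} (h : ∀ w ∈ S, ¬ G.Adj v w) :
    G.weightIn x v S = 0 := by
  classical
  rw [weightIn, Finset.filter_false_of_mem h, Finset.sum_empty]

/-- A path on `2k` vertices inside N(u) closes through `u` to a C_{2k+1}, so N(u) has bounded
average degree. -/
theorem sum_degreeIn_neighbors_le {k : ℕ} (hk : 1 ≤ k) (hfree : (cycleGraph (2 * k + 1)).Free G)
    (u : V) (X : Finset V) (hX : ∀ v ∈ X, G.Adj u v) :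
    ∑ v ∈ X, G.degreeIn v X ≤ 2 * (2 * k - 2) * X.card := by
  by_contra! hc
  obtain ⟨T, hTX, ⟨v, hv⟩, hT⟩ := exists_subset_forall_lt_degreeIn (2 * k - 2) X hc
  obtain ⟨w, hw, p, hp, hpl, hps⟩ := exists_path_of_forall_lt_degreeIn (2 * k - 2) T hT v hv
    (2 * k - 1) (by omega)
  refine not_adj_of_path_of_cycleGraph_free hk hfree (.cons (hX w (hTX hw)) p) ?_
    (by simp [hpl]; omega) (hX v (hTX hv)).symm
  rw [Walk.cons_isPath_iff]
  exact ⟨hp, fun hc => G.irrefl (hX u (hTX (hps u hc)))⟩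

variable [Fintype V]

/-- A nonnegative nonzero vector `x` with `lam • x ≤ A x` for the adjacency matrix `A` of `G`. -/
structure IsSubEigenvector (G : SimpleGraph V) (x : V → ℝ) (lam : ℝ) : Prop where
  nonneg : ∀ v, 0 ≤ x v
  exists_pos : ∃ v, 0 < x v
  mul_le : ∀ v, lam * x v ≤ G.weightIn x v Finset.univ

theorem IsSubEigenvector.exists_max {x : V → ℝ} {lam : ℝ} (h : G.IsSubEigenvector x lam) :
    ∃ u, (∀ v, x v ≤ x u) ∧ 0 < x u := by
  obtain ⟨v, hv⟩ := h.exists_pos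
  obtain ⟨u, -, hu⟩ := Finset.exists_max_image Finset.univ x ⟨v, Finset.mem_univ v⟩
  exact ⟨u, fun w => hu w (Finset.mem_univ w), hv.trans_le (hu v (Finset.mem_univ v))⟩

/-- Take `X = N(u)` for a maximal entry `u`. Then λ² is at most the degree sum over `X`, of which
the part inside `X` is at most `4k|X|`, so nearly all of `n²/4` is accounted for by edges from `X`
to its complement. -/
theorem IsSubEigenvector.exists_isDensePair {x : V → ℝ} {lam : ℝ} {k : ℕ}
    (h : G.IsSubEigenvector x lam) (hk : 2 ≤ k) (hn : 712 * k ≤ Fintype.card V)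
    (hfree : (cycleGraph (2 * k + 1)).Free G)
    (hlam : (Fintype.card V - 2 * k : ℝ) / 2 ≤ lam) : ∃ X Y, G.IsDensePair k X Y := by
  classical
  obtain ⟨u, hu, hu0⟩ := h.exists_max
  set N : ℝ := (Fintype.card V : ℝ) with hN
  have hkN : 712 * (k : ℝ) ≤ N := by rw [hN]; exact_mod_cast hn
  have hk2 : (2 : ℝ) ≤ k := by exact_mod_cast hk
  let X : Finset V := Finset.univ.filter (G.Adj u)
  have hXY : X ∪ Xᶜ = Finset.univ := Finset.union_compl X
  have hdis : Disjoint X Xᶜ := disjoint_compl_right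
  have hcard : (X.card + (Xᶜ).card : ℝ) = N := by
    rw [hN, ← Finset.card_univ, ← hXY, Finset.card_union_of_disjoint hdis]
    push_cast
    rfl
  have hlam0 : 0 ≤ lam := le_trans (by linarith) hlam
  have hsq : lam ^ 2 ≤ ∑ v ∈ X, (G.degreeIn v Finset.univ : ℝ) := by
    have h1 : lam ^ 2 * x u ≤ (∑ v ∈ X, (G.degreeIn v Finset.univ : ℝ)) * x u := by
      calc lam ^ 2 * x u = lam * (lam * x u) := by ring
        _ ≤ lam * ∑ v ∈ X, x v := by
          refine mul_le_mul_of_nonneg_left ((h.mul_le u).trans ?_) hlam0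
          rw [weightIn]
        _ = ∑ v ∈ X, lam * x v := Finset.mul_sum _ _ _
        _ ≤ ∑ v ∈ X, G.degreeIn v Finset.univ * x u :=
          Finset.sum_le_sum fun v _ => (h.mul_le v).trans (weightIn_le_degreeIn_mul hu v _)
        _ = _ := by rw [Finset.sum_mul]
    exact le_of_mul_le_mul_right h1 hu0
  have hsplit : ∑ v ∈ X, (G.degreeIn v Finset.univ : ℝ) =
      ∑ v ∈ X, (G.degreeIn v X : ℝ) + ∑ v ∈ X, (G.degreeIn v Xᶜ : ℝ) := by
    rw [← Finset.sum_add_distrib]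
    refine Finset.sum_congr rfl fun v _ => ?_
    rw [← hXY, degreeIn_union v hdis]
    push_cast
    rfl
  have hin : ∑ v ∈ X, (G.degreeIn v X : ℝ) ≤ 4 * k * X.card := by
    have h1 := sum_degreeIn_neighbors_le (by omega) hfree u X (by simp [X])
    have h2 : 2 * (2 * k - 2) * X.card ≤ 4 * k * X.card := Nat.mul_le_mul_right _ (by omega)
    exact_mod_cast h1.trans h2
  have hle : ∑ v ∈ X, (G.degreeIn v Xᶜ : ℝ) ≤ X.card * (Xᶜ).card := by
    rw [← nsmul_eq_mul]
    exact Finset.sum_le_card_nsmul _ _ _ fun v _ => by exact_mod_cast degreeIn_le_card v _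
  have hl2 : ((N - 2 * k) / 2) ^ 2 ≤ lam ^ 2 := by
    apply pow_le_pow_left₀ _ hlam
    linarith
  set ξ : ℝ := (X.card : ℝ) with hξ
  set η : ℝ := ((Xᶜ).card : ℝ)
  have hη0 : 0 ≤ η := Nat.cast_nonneg _
  have hξ0 : 0 ≤ ξ := Nat.cast_nonneg _
  have hηe : η = N - ξ := by linarith
  -- The left side is `N²/4 - ξη ≤ kN + 4kξ ≤ 5kN`, and `5 / 712 < 0.084²`.
  have hdev : (ξ - N / 2) ^ 2 ≤ (0.084 * N) ^ 2 := by
    rw [hηe] at hle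
    have e1 : (k : ℝ) * ξ ≤ k * N := mul_le_mul_of_nonneg_left (by linarith) (by linarith)
    have e2 : 712 * (k : ℝ) * N ≤ N * N := mul_le_mul_of_nonneg_right hkN (by linarith)
    nlinarith
  have habs := abs_le.mp (abs_le_of_sq_le_sq hdev (by linarith))
  refine ⟨X, Xᶜ, hk, hn, hdis, fun v => by rw [← Finset.mem_union, hXY]; simp, ?_, ?_, ?_⟩
  · linarith [habs.2]
  · change η ≤ _
    linarith [habs.1]
  · change ξ * η ≤ _
    -- Inserting the improved bound on `ξ` makes the number of missing pairs at most `(1 + 4 ·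
    -- 0.584) kN < 0.0047 N²`.
    have e1 : (k : ℝ) * ξ ≤ k * (0.584 * N) :=
      mul_le_mul_of_nonneg_left (by linarith [habs.2]) (by linarith)
    have e2 : 712 * (k : ℝ) * N ≤ N * N := mul_le_mul_of_nonneg_right hkN (by linarith)
    rw [hηe]
    nlinarith [sq_nonneg (ξ - N / 2)]

/-! ### Eigenvector estimates on a core, and the cost of outside vertices. -/

namespace IsCore

variable {k : ℕ} {A B : Finset V}

open Classical in
/-- The vertices outside of the two sides of a core. -/
noncomputable def rest (A B : Finset V) : Finset V := (A ∪ B)ᶜ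

theorem mem_rest {w : V} : w ∈ rest A B ↔ w ∉ A ∧ w ∉ B := by
  simp [rest]

theorem rest_comm (A B : Finset V) : rest A B = rest B A := by
  ext w
  rw [mem_rest, mem_rest, and_comm]

theorem weightIn_univ (h : G.IsCore k A B) (x : V → ℝ) (v : V) :
    G.weightIn x v Finset.univ =
      G.weightIn x v A + G.weightIn x v B + G.weightIn x v (rest A B) := by
  classical
  rw [← weightIn_union x v h.disjoint, ← weightIn_union x v, rest]
  · congr 1
    ext w
    simp only [Finset.mem_univ, Finset.mem_union, Finset.mem_compl, true_iff]
    tauto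
  · rw [rest]
    convert (disjoint_compl_right : Disjoint (A ∪ B) (A ∪ B)ᶜ)

theorem card_add_card_add_card (h : G.IsCore k A B) :
    A.card + B.card + (rest A B).card = Fintype.card V := by
  classical
  rw [← Finset.card_union_of_disjoint h.disjoint, rest]
  convert Finset.card_add_card_compl (A ∪ B)

theorem card_rest_le (h : G.IsCore k A B) :
    ((rest A B).card : ℝ) ≤ 0.028 * Fintype.card V :=
  h.card_le _ fun _ hw => mem_rest.mp hw

theorem degreeIn_eq_zero_or (h : G.IsCore k A B) (w : V) :
    G.degreeIn w A = 0 ∨ G.degreeIn w B = 0 := by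
  by_contra! hc
  obtain ⟨a, ha, hwa⟩ := degreeIn_pos_iff.mp (Nat.pos_of_ne_zero hc.1)
  obtain ⟨b, hb, hwb⟩ := degreeIn_pos_iff.mp (Nat.pos_of_ne_zero hc.2)
  exact h.one_side w a ha b hb hwa hwb

theorem degreeIn_add_degreeIn_le (h : G.IsCore k A B) {w : V} (hw : w ∈ rest A B) :
    (G.degreeIn w A + G.degreeIn w B : ℝ) ≤ 0.094 * Fintype.card V := by
  rw [mem_rest] at hw
  rcases h.degreeIn_eq_zero_or w with h0 | h0
  · rw [h0]
    simpa using h.degreeIn_right_le w hw.1 hw.2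
  · rw [h0]
    simpa using h.degreeIn_left_le w hw.1 hw.2

theorem cast_le_card (h : G.IsCore k A B) : 712 * (k : ℝ) ≤ Fintype.card V := by
  exact_mod_cast h.le_card

theorem two_le_cast (h : G.IsCore k A B) : (2 : ℝ) ≤ k := by
  exact_mod_cast h.two_le

variable {x : V → ℝ} {lam : ℝ}

/-- An outside vertex has at most `(0.094 + 0.028) n` neighbours, less than a quarter of `lam ≥
0.498 n`. -/
theorem rest_le (h : G.IsCore k A B) (hx : G.IsSubEigenvector x lam)
    (hlam : (Fintype.card V - 2 * k : ℝ) / 2 ≤ lam) {M : ℝ} (hM : ∀ v, x v ≤ M) {w : V}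
    (hw : w ∈ rest A B) : x w ≤ M / 4 := by
  have h1 := hx.mul_le w
  rw [h.weightIn_univ] at h1
  have hA := weightIn_le_degreeIn_mul (G := G) hM w A
  have hB := weightIn_le_degreeIn_mul (G := G) hM w B
  have hZ := weightIn_le_degreeIn_mul (G := G) hM w (rest A B)
  have hd : (G.degreeIn w (rest A B) : ℝ) ≤ (rest A B).card := by
    exact_mod_cast degreeIn_le_card w _
  have hM0 : 0 ≤ M := (hx.nonneg w).trans (hM w)
  have h2 := h.degreeIn_add_degreeIn_le hw
  have h3 := h.card_rest_le
  have h4 := h.cast_le_card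
  have h5 := h.two_le_cast
  set N : ℝ := (Fintype.card V : ℝ)
  have h6 : lam * x w ≤ (0.122 * N) * M := by
    have : (G.degreeIn w A + G.degreeIn w B + G.degreeIn w (rest A B) : ℝ) * M ≤
      (0.122 * N) * M := mul_le_mul_of_nonneg_right (by linarith) hM0
    linarith
  have h7 : 0.498 * N * x w ≤ lam * x w :=
    mul_le_mul_of_nonneg_right (by linarith) (hx.nonneg w)
  have h8 : N * (0.498 * x w) ≤ N * (0.122 * M) := by linarith
  have h9 := le_of_mul_le_mul_left h8 (by linarith)
  linarith

theorem mul_sum_le (h : G.IsCore k A B) (hx : G.IsSubEigenvector x lam) {p : ℕ}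
    (hp : ∀ b ∈ B, G.degreeIn b A ≤ p) :
    lam * ∑ a ∈ A, x a ≤ p * ∑ b ∈ B, x b + ∑ w ∈ rest A B, G.degreeIn w A * x w := by
  calc lam * ∑ a ∈ A, x a = ∑ a ∈ A, lam * x a := Finset.mul_sum _ _ _
    _ ≤ ∑ a ∈ A, (G.weightIn x a B + G.weightIn x a (rest A B)) :=
      Finset.sum_le_sum fun a ha => by
        have h1 := hx.mul_le a
        rw [h.weightIn_univ, weightIn_eq_zero (h.not_adj_left a ha)] at h1
        linarith
    _ = ∑ b ∈ B, G.degreeIn b A * x b + ∑ w ∈ rest A B, G.degreeIn w A * x w := by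
      rw [Finset.sum_add_distrib, sum_weightIn_eq, sum_weightIn_eq]
    _ ≤ _ := by
      rw [Finset.mul_sum]
      gcongr with b hb
      · exact hx.nonneg b
      · exact hp b hb

theorem sum_degreeIn_mul_le (h : G.IsCore k A B) (hx : G.IsSubEigenvector x lam)
    (hlam : (Fintype.card V - 2 * k : ℝ) / 2 ≤ lam) {M : ℝ} (hM : ∀ v, x v ≤ M)
    (S : Finset V) (hS : S ⊆ rest A B) :
    ∑ w ∈ S, G.degreeIn w A * x w ≤ S.card * (0.0235 * Fintype.card V * M) := by
  rw [← nsmul_eq_mul]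
  refine Finset.sum_le_card_nsmul _ _ _ fun w hw => ?_
  have h1 := h.rest_le hx hlam hM (hS hw)
  have h2 := mem_rest.mp (hS hw)
  have h3 := h.degreeIn_left_le w h2.1 h2.2
  have h4 := hx.nonneg w
  calc (G.degreeIn w A : ℝ) * x w ≤ (0.094 * Fintype.card V) * (M / 4) :=
        mul_le_mul h3 h1 h4 (by positivity)
    _ = _ := by ring

/-- The inequality at `u` makes the weight of `B` nearly `n/2` times the maximum; summing it over
`B`, with `|B| ≤ 0.598 n`, transfers this to `A`. -/
theorem le_sum_of_mem (h : G.IsCore k A B) (hx : G.IsSubEigenvector x lam)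
    (hlam : (Fintype.card V - 2 * k : ℝ) / 2 ≤ lam) {u : V} (hM : ∀ v, x v ≤ x u) (hu : u ∈ A) :
    0.4 * Fintype.card V * x u ≤ ∑ b ∈ B, x b ∧ 0.4 * Fintype.card V * x u ≤ ∑ a ∈ A, x a := by
  have h1 := hx.mul_le u
  rw [h.weightIn_univ, weightIn_eq_zero (h.not_adj_left u hu)] at h1
  have h2 := weightIn_le_sum (G := G) hx.nonneg u B
  have h3 := weightIn_le_sum (G := G) hx.nonneg u (rest A B)
  have h4 : ∑ w ∈ rest A B, x w ≤ (rest A B).card * (x u / 4) := by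
    rw [← nsmul_eq_mul]
    exact Finset.sum_le_card_nsmul _ _ _ fun w hw => h.rest_le hx hlam hM hw
  have h5 := h.card_rest_le
  have h6 := h.cast_le_card
  have h7 := h.two_le_cast
  have h8 := hx.nonneg u
  have h9 := h.card_right_le
  have h10 := h.symm.mul_sum_le hx (p := B.card) (fun a _ => degreeIn_le_card a B)
  have h11 := h.symm.sum_degreeIn_mul_le hx hlam hM (rest B A) subset_rfl
  rw [rest_comm B A] at h10 h11
  set N : ℝ := (Fintype.card V : ℝ)
  set M := x u
  set σA := ∑ a ∈ A, x a
  set σB := ∑ b ∈ B, x b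
  have hσA : 0 ≤ σA := Finset.sum_nonneg fun v _ => hx.nonneg v
  have hNM : 0 ≤ N * M := mul_nonneg (by linarith) h8
  have e1 : 0.498 * N * M ≤ lam * M := mul_le_mul_of_nonneg_right (by linarith) h8
  have e2 : ((rest A B).card : ℝ) * (M / 4) ≤ 0.028 * N * (M / 4) :=
    mul_le_mul_of_nonneg_right h5 (by linarith)
  have e3 : 0.49 * N * M ≤ σB := by nlinarith
  refine ⟨by nlinarith, ?_⟩
  have e4 : 0.498 * N * (0.49 * N * M) ≤ lam * σB :=
    mul_le_mul (by linarith) e3 (by nlinarith) (by linarith)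
  have e5 : ((rest A B).card : ℝ) * (0.0235 * N * M) ≤ 0.028 * N * (0.0235 * N * M) :=
    mul_le_mul_of_nonneg_right h5 (by nlinarith)
  have e6 : (B.card : ℝ) * σA ≤ 0.598 * N * σA := mul_le_mul_of_nonneg_right h9 hσA
  have e7 : N * (0.598 * (0.4 * N * M)) ≤ N * (0.598 * σA) := by
    nlinarith [mul_nonneg hNM (by linarith : 0 ≤ N)]
  have e8 := le_of_mul_le_mul_left e7 (by linarith)
  linarith

theorem le_sum (h : G.IsCore k A B) (hx : G.IsSubEigenvector x lam)
    (hlam : (Fintype.card V - 2 * k : ℝ) / 2 ≤ lam) {u : V} (hM : ∀ v, x v ≤ x u) (hu : 0 < x u) :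
    0.4 * Fintype.card V * x u ≤ ∑ b ∈ B, x b ∧ 0.4 * Fintype.card V * x u ≤ ∑ a ∈ A, x a := by
  by_cases hA : u ∈ A
  · exact h.le_sum_of_mem hx hlam hM hA
  by_cases hB : u ∈ B
  · exact (h.symm.le_sum_of_mem hx hlam hM hB).symm
  have := h.rest_le hx hlam hM (mem_rest.mpr ⟨hA, hB⟩)
  linarith

/-- Multiplying `λσ_A ≤ (p + ε)σ_B` by `λσ_B ≤ (q + ε)σ_A` cancels the weights; AM-GM then turns `λ²
≤ (p + ε)(q + ε)` into a linear bound. -/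
theorem two_mul_le (h : G.IsCore k A B) (hx : G.IsSubEigenvector x lam)
    (hlam : (Fintype.card V - 2 * k : ℝ) / 2 ≤ lam) {u : V} (hM : ∀ v, x v ≤ x u) (hu : 0 < x u)
    {p q : ℕ} (hp : ∀ b ∈ B, G.degreeIn b A ≤ p) (hq : ∀ a ∈ A, G.degreeIn a B ≤ q) {ε : ℝ}
    (hε : 0 ≤ ε)
    (hεA : ∑ w ∈ rest A B, G.degreeIn w A * x w ≤ ε * (0.4 * Fintype.card V * x u))
    (hεB : ∑ w ∈ rest A B, G.degreeIn w B * x w ≤ ε * (0.4 * Fintype.card V * x u)) :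
    2 * lam ≤ p + q + 2 * ε := by
  obtain ⟨hσB, hσA⟩ := h.le_sum hx hlam hM hu
  have h1 := h.mul_sum_le hx hp
  have h2 := h.symm.mul_sum_le hx hq
  rw [rest_comm B A] at h2
  have h6 := h.cast_le_card
  have h7 := h.two_le_cast
  have hpos : 0 < 0.4 * (Fintype.card V : ℝ) * x u := mul_pos (by linarith) hu
  have hlam0 : 0 ≤ lam := by linarith
  set σA := ∑ a ∈ A, x a
  set σB := ∑ b ∈ B, x b
  have hA0 : 0 < σA := by linarith
  have hB0 : 0 < σB := by linarith
  have e1 : lam * σA ≤ (p + ε) * σB := by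
    have := mul_le_mul_of_nonneg_left hσB hε
    linarith
  have e2 : lam * σB ≤ (q + ε) * σA := by
    have := mul_le_mul_of_nonneg_left hσA hε
    linarith
  have e3 : (lam * σA) * (lam * σB) ≤ ((p + ε) * σB) * ((q + ε) * σA) :=
    mul_le_mul e1 e2 (by positivity) (by positivity)
  have e4 : lam ^ 2 * (σA * σB) ≤ ((p + ε) * (q + ε)) * (σA * σB) := by linarith
  have e5 := le_of_mul_le_mul_right e4 (mul_pos hA0 hB0)
  have hp0 : (0 : ℝ) ≤ p := p.cast_nonneg
  have hq0 : (0 : ℝ) ≤ q := q.cast_nonneg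
  have := le_abs_self _ |>.trans <| abs_le_of_sq_le_sq (a := 2 * lam) (b := p + q + 2 * ε)
    (by nlinarith [sq_nonneg ((p : ℝ) - q)]) (by positivity)
  exact this

/-- With `z` outside vertices, `n - 2k ≤ 2λ ≤ n - z + z/8`. -/
theorem card_rest_le_mul (h : G.IsCore k A B) (hx : G.IsSubEigenvector x lam)
    (hlam : (Fintype.card V - 2 * k : ℝ) / 2 ≤ lam) :
    ((rest A B).card : ℝ) ≤ 16 / 7 * k := by
  obtain ⟨u, hM, hu⟩ := hx.exists_max
  have hA := h.sum_degreeIn_mul_le hx hlam hM (rest A B) subset_rfl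
  have hB := h.symm.sum_degreeIn_mul_le hx hlam hM (rest B A) subset_rfl
  rw [rest_comm B A] at hB
  set z : ℝ := ((rest A B).card : ℝ) with hz
  have hz0 : 0 ≤ z := Nat.cast_nonneg _
  have hNM : 0 ≤ z * (Fintype.card V * x u) := by positivity
  have h1 := h.two_mul_le hx hlam hM hu (fun b _ => degreeIn_le_card b A)
    (fun a _ => degreeIn_le_card a B) (ε := z / 16) (by positivity) (by linarith) (by linarith)
  have h2 : (A.card + B.card + z : ℝ) = Fintype.card V := by
    rw [hz]
    exact_mod_cast h.card_add_card_add_card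
  linarith

open Classical in
/-- The vertices outside of a core with at most one neighbour in it. -/
noncomputable def restLow (G : SimpleGraph V) (A B : Finset V) : Finset V :=
  (rest A B).filter fun w => G.degreeIn w A + G.degreeIn w B ≤ 1

open Classical in
/-- The vertices outside of a core with at least two neighbours in it. -/
noncomputable def restHigh (G : SimpleGraph V) (A B : Finset V) : Finset V :=
  (rest A B).filter fun w => ¬ G.degreeIn w A + G.degreeIn w B ≤ 1

theorem mem_restLow {w : V} : w ∈ restLow G A B ↔
    w ∈ rest A B ∧ G.degreeIn w A + G.degreeIn w B ≤ 1 := by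
  simp [restLow]

theorem mem_restHigh {w : V} : w ∈ restHigh G A B ↔
    w ∈ rest A B ∧ ¬ G.degreeIn w A + G.degreeIn w B ≤ 1 := by
  simp [restHigh]

theorem restHigh_comm : restHigh G A B = restHigh G B A := by
  ext w
  rw [mem_restHigh, mem_restHigh, rest_comm, add_comm]

theorem card_restLow_add_card_restHigh :
    (restLow G A B).card + (restHigh G A B).card = (rest A B).card := by
  classical
  exact Finset.card_filter_add_card_filter_not _

/-- Low vertices have entries of order 1/n times `k` times the maximum, and there are only O(k) of
them, so together they fit into the constant 0.0005; only high vertices contribute a visible error.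
-/
theorem sum_degreeIn_mul_le_card_restHigh (h : G.IsCore k A B) (hx : G.IsSubEigenvector x lam)
    (hlam : (Fintype.card V - 2 * k : ℝ) / 2 ≤ lam) {u : V} (hM : ∀ v, x v ≤ x u) :
    ∑ w ∈ rest A B, G.degreeIn w A * x w ≤
      ((restHigh G A B).card / 16 + 0.0005) * (0.4 * Fintype.card V * x u) := by
  classical
  have hz := h.card_rest_le_mul hx hlam
  have h6 := h.cast_le_card
  have h7 := h.two_le_cast
  have h8 := hx.nonneg u
  have hhigh := h.sum_degreeIn_mul_le hx hlam hM (restHigh G A B) (Finset.filter_subset _ _)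
  have hlow : ∑ w ∈ restLow G A B, G.degreeIn w A * x w ≤
      (restLow G A B).card * (0.0031 * x u) := by
    rw [← nsmul_eq_mul]
    refine Finset.sum_le_card_nsmul _ _ _ fun w hw => ?_
    rw [mem_restLow] at hw
    have hx0 := hx.nonneg w
    have e1 : (G.degreeIn w A : ℝ) ≤ 1 := by exact_mod_cast (by omega : G.degreeIn w A ≤ 1)
    have e2 : (G.degreeIn w A + G.degreeIn w B : ℝ) ≤ 1 := by exact_mod_cast hw.2
    have e3 := hx.mul_le w
    rw [h.weightIn_univ] at e3
    have hA := weightIn_le_degreeIn_mul (G := G) hM w A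
    have hB := weightIn_le_degreeIn_mul (G := G) hM w B
    have hZ := weightIn_le_sum (G := G) hx.nonneg w (rest A B)
    have hZ' : ∑ w ∈ rest A B, x w ≤ (rest A B).card * (x u / 4) := by
      rw [← nsmul_eq_mul]
      exact Finset.sum_le_card_nsmul _ _ _ fun w hw => h.rest_le hx hlam hM hw
    set N : ℝ := (Fintype.card V : ℝ)
    have e4 : ((rest A B).card : ℝ) * (x u / 4) ≤ 16 / 7 * k * (x u / 4) :=
      mul_le_mul_of_nonneg_right hz (by linarith)
    have e5 : (G.degreeIn w A + G.degreeIn w B : ℝ) * x u ≤ k / 2 * x u :=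
      mul_le_mul_of_nonneg_right (by linarith) h8
    have e6 : lam * x w ≤ 1.08 * k * x u := by nlinarith [mul_nonneg (by linarith : (0 : ℝ) ≤ k) h8]
    have e7 : 0.498 * N * x w ≤ lam * x w := mul_le_mul_of_nonneg_right (by linarith) hx0
    have e8 : 0.498 * (712 * k) * x w ≤ 0.498 * N * x w := by gcongr
    have e9 : (k : ℝ) * (354 * x w) ≤ k * (1.08 * x u) := by
      nlinarith [mul_nonneg (by linarith : (0 : ℝ) ≤ k) hx0]
    have e10 := le_of_mul_le_mul_left e9 (by linarith)
    calc (G.degreeIn w A : ℝ) * x w ≤ 1 * x w := mul_le_mul_of_nonneg_right e1 hx0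
      _ ≤ _ := by linarith
  have hlowz : ((restLow G A B).card : ℝ) ≤ 16 / 7 * k := by
    refine le_trans ?_ hz
    exact_mod_cast Finset.card_filter_le _ _
  have hsplit : ∑ w ∈ rest A B, G.degreeIn w A * x w =
      ∑ w ∈ restLow G A B, G.degreeIn w A * x w + ∑ w ∈ restHigh G A B, G.degreeIn w A * x w :=
    (Finset.sum_filter_add_sum_filter_not _ _ _).symm
  rw [hsplit]
  set N : ℝ := (Fintype.card V : ℝ)
  set H : ℝ := ((restHigh G A B).card : ℝ)
  have hH : 0 ≤ H * (N * x u) :=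
    mul_nonneg (Nat.cast_nonneg _) (mul_nonneg (by linarith) h8)
  have e1 : ((restLow G A B).card : ℝ) * (0.0031 * x u) ≤ 16 / 7 * k * (0.0031 * x u) :=
    mul_le_mul_of_nonneg_right hlowz (by linarith)
  have e2 : 712 * k * x u ≤ N * x u := mul_le_mul_of_nonneg_right h6 h8
  have e3 : 0 ≤ k * x u := mul_nonneg (by linarith) h8
  linarith

/-- With `L` low and `H` high vertices, `2λ ≤ n - L - 7H/8 - e + 0.001`. Were the integer inequality
to fail, it would fail by at least 1/8, pushing `2λ` below `n - r + 1 - 0.1`. The parameter `e`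
records a loss in the degree bounds inside the core. -/
theorem card_restLow_add_le (h : G.IsCore k A B) (hx : G.IsSubEigenvector x lam) {r : ℕ}
    (hr : 1 ≤ r) (hrk : r ≤ 2 * k) (hlam0 : 0 ≤ lam)
    (hlam : (Fintype.card V - r + 1 : ℝ) ^ 2 - 1 ≤ 4 * lam ^ 2) {p q e : ℕ}
    (hp : ∀ b ∈ B, G.degreeIn b A ≤ p) (hq : ∀ a ∈ A, G.degreeIn a B ≤ q)
    (hpq : p + q + e ≤ A.card + B.card) :
    8 * (restLow G A B).card + 7 * (restHigh G A B).card + 8 * e ≤ 8 * (r - 1) := by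
  obtain ⟨u, hM, hu⟩ := hx.exists_max
  have h6 := h.cast_le_card
  have h7 := h.two_le_cast
  have hrk' : (r : ℝ) ≤ 2 * k := by exact_mod_cast hrk
  have hl : (Fintype.card V - 2 * k : ℝ) / 2 ≤ lam := by
    have := abs_le_of_sq_le_sq (a := (Fintype.card V - 2 * k : ℝ)) (b := 2 * lam)
      (by nlinarith) (by linarith)
    linarith [le_abs_self (Fintype.card V - 2 * k : ℝ)]
  have hA := h.sum_degreeIn_mul_le_card_restHigh hx hl hM
  have hB := h.symm.sum_degreeIn_mul_le_card_restHigh hx hl hM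
  rw [rest_comm B A, restHigh_comm] at hB
  have h1 := h.two_mul_le hx hl hM hu hp hq (by positivity) hA hB
  have h2 := h.card_add_card_add_card
  rw [← card_restLow_add_card_restHigh (G := G)] at h2
  by_contra! hc
  have h3 : (A.card + B.card + ((restLow G A B).card + (restHigh G A B).card) : ℝ) =
    Fintype.card V := by exact_mod_cast h2
  have h4 : (p + q + e : ℝ) ≤ A.card + B.card := by exact_mod_cast hpq
  have h5 : (8 * r + 1 : ℝ) ≤ 8 * (restLow G A B).card + 7 * (restHigh G A B).card + 8 * e + 8 := by
    exact_mod_cast (by omega)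
  have h8 : 2 * lam ≤ (Fintype.card V - r + 1 : ℝ) - 0.1 := by linarith
  have h9 : (2 * lam) ^ 2 ≤ ((Fintype.card V - r + 1 : ℝ) - 0.1) ^ 2 :=
    pow_le_pow_left₀ (by linarith) h8 2
  nlinarith

end IsCore

end SimpleGraph

/-! ### Colouring arguments: the outside vertices form a clique attached at one vertex. -/

namespace SimpleGraph

variable {V : Type*} {G : SimpleGraph V}

theorem colorable_card_add_two (T : Finset V) (g : V → Bool)
    (hg : ∀ u v, u ∉ T → v ∉ T → G.Adj u v → g u ≠ g v) : G.Colorable (T.card + 2) := by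
  classical
  let c : G.Coloring (T ⊕ Bool) := Coloring.mk
    (fun v => if h : v ∈ T then .inl ⟨v, h⟩ else .inr (g v)) (by
      intro u v huv
      by_cases hu : u ∈ T <;> by_cases hv : v ∈ T <;> simp only [hu, hv, dite_true, dite_false]
      · simpa using huv.ne
      · simp
      · simp
      · simpa using hg u v hu hv huv)
  have := c.colorable
  simpa using this

theorem exists_adj_ne_of_two_le_degreeIn {w c : V} {S : Finset V} (h : 2 ≤ G.degreeIn w S) :
    ∃ a ∈ S, G.Adj w a ∧ a ≠ c := by
  classical
  obtain ⟨a, ha, hac⟩ := Finset.exists_mem_ne (by rwa [degreeIn] at h) c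
  rw [Finset.mem_filter] at ha
  exact ⟨a, ha.1, ha.2, hac⟩

variable [Fintype V]

namespace IsCore

variable {k r : ℕ} {A B : Finset V}

/-- Colour `A` by `false`, `B` by `true`, the remaining outside vertices by `f`, and give each
vertex of `T` its own colour. -/
theorem le_card_add_two (h : G.IsCore k A B) (hchi : ∀ N, G.Colorable N → r ≤ N) (T : Finset V)
    (f : V → Bool) (hA : ∀ w ∈ rest A B, w ∉ T → 0 < G.degreeIn w A → f w = true)
    (hB : ∀ w ∈ rest A B, w ∉ T → 0 < G.degreeIn w B → f w = false)
    (hf : ∀ w ∈ rest A B, ∀ w' ∈ rest A B, w ∉ T → w' ∉ T → G.Adj w w' → f w ≠ f w') :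
    r ≤ T.card + 2 := by
  classical
  have hdis : ∀ {v}, v ∈ A → v ∉ B := fun h1 h2 => Finset.disjoint_left.mp h.disjoint h1 h2
  let g : V → Bool := fun v => if v ∈ A then false else if v ∈ B then true else f v
  have gA : ∀ {v}, v ∈ A → g v = false := fun hv => by simp [g, hv]
  have gB : ∀ {v}, v ∈ B → g v = true := fun hv => by
    have : _ ∉ A := fun hc => hdis hc hv
    simp [g, hv, this]
  have gZ : ∀ {v}, v ∉ A → v ∉ B → g v = f v := fun h1 h2 => by simp [g, h1, h2]
  have half : ∀ u v, u ∉ T → v ∉ T → G.Adj u v → (u ∈ A ∨ u ∈ B) → g u ≠ g v := by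
    rintro u v - hv huv (hu | hu)
    · rw [gA hu]
      by_cases hvB : v ∈ B
      · simp [gB hvB]
      have hvA : v ∉ A := fun hc => h.not_adj_left u hu v hc huv
      rw [gZ hvA hvB, hA v (mem_rest.mpr ⟨hvA, hvB⟩) hv (degreeIn_pos_iff.mpr ⟨u, hu, huv.symm⟩)]
      simp
    · rw [gB hu]
      by_cases hvA : v ∈ A
      · simp [gA hvA]
      have hvB : v ∉ B := fun hc => h.not_adj_right u hu v hc huv
      rw [gZ hvA hvB, hB v (mem_rest.mpr ⟨hvA, hvB⟩) hv (degreeIn_pos_iff.mpr ⟨u, hu, huv.symm⟩)]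
      simp
  refine hchi _ (colorable_card_add_two T g fun u v hu hv huv => ?_)
  by_cases hu' : u ∈ A ∨ u ∈ B
  · exact half u v hu hv huv hu'
  by_cases hv' : v ∈ A ∨ v ∈ B
  · exact (half v u hv hu huv.symm hv').symm
  push Not at hu' hv'
  rw [gZ hu'.1 hu'.2, gZ hv'.1 hv'.2]
  exact hf u (mem_rest.mpr hu') v (mem_rest.mpr hv') hu hv huv

variable {x : V → ℝ} {lam : ℝ}

/-- An edge outside of the core does not attach to two different vertices of the same side. -/
theorem not_ear (h : G.IsCore k A B) (hx : G.IsSubEigenvector x lam)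
    (hr : 3 ≤ r) (hrk : r ≤ 2 * k) (hlam0 : 0 ≤ lam)
    (hlam : (Fintype.card V - r + 1 : ℝ) ^ 2 - 1 ≤ 4 * lam ^ 2)
    (hchi : ∀ N, G.Colorable N → r ≤ N) {w w' a a' : V} (hw : w ∈ rest A B) (hw' : w' ∈ rest A B)
    (ha : a ∈ A) (ha' : a' ∈ A) (hww : G.Adj w w') (hwa : G.Adj w a) (hwa' : G.Adj w' a') :
    a = a' := by
  classical
  by_contra hne
  have hwZ := mem_rest.mp hw
  have hwZ' := mem_rest.mp hw'
  obtain ⟨hk, hnb⟩ := h.ear_left w w' a a' hwZ.2 hwZ'.2 ha ha' hne hww hwa hwa'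
  have hdeg : ∀ b ∈ B, G.degreeIn b A ≤ A.card - 1 := by
    intro b hb
    obtain ⟨c, hc, hbc⟩ : ∃ c ∈ A, ¬ G.Adj b c := by
      by_cases hba : G.Adj b a
      · exact ⟨a', ha', hnb b hb hba⟩
      · exact ⟨a, ha, hba⟩
    refine Nat.le_sub_one_of_lt ?_
    rw [degreeIn]
    exact Finset.card_lt_card (Finset.filter_ssubset.mpr ⟨c, hc, hbc⟩)
  have hApos : 0 < A.card := Finset.card_pos.mpr ⟨a, ha⟩
  -- Every `b` misses `a` or `a'`, which gains `e = 1`. As `k = 2` forces `r ≤ 4`, the count leaves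
  -- only `w` and `w'` outside and `r = 4`; but `w'` alone needs an extra colour, so `r ≤ 3`.
  have h1 := h.card_restLow_add_le hx (by omega) hrk hlam0 hlam hdeg
    (fun a _ => degreeIn_le_card a B) (e := 1) (by omega)
  have h2 := card_restLow_add_card_restHigh (G := G) (A := A) (B := B)
  have h3 : 1 < (rest A B).card := Finset.one_lt_card.mpr ⟨w, hw, w', hw', hww.ne⟩
  have h4 : (rest A B).card = 2 := by omega
  have h5 : rest A B = {w, w'} := by
    refine (Finset.eq_of_subset_of_card_le ?_ ?_).symm
    · intro v hv
      rw [Finset.mem_insert, Finset.mem_singleton] at hv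
      rcases hv with rfl | rfl <;> assumption
    · rw [h4, Finset.card_pair hww.ne]
  have h6 : ∀ v ∈ rest A B, v ∉ ({w'} : Finset V) → v = w := by
    intro v hv hvw
    rw [h5] at hv
    simp only [Finset.mem_insert, Finset.mem_singleton] at hv hvw
    tauto
  have h7 := h.le_card_add_two hchi {w'} (fun _ => true) (fun _ _ _ _ => rfl) (by
      intro v hv hvw hvB
      obtain rfl := h6 v hv hvw
      obtain ⟨b, hb, hvb⟩ := degreeIn_pos_iff.mp hvB
      exact absurd hvb (h.one_side v a ha b hb hwa)) (by
      intro v hv v' hv' hvw hvw' hadj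
      rw [h6 v hv hvw, h6 v' hv' hvw'] at hadj
      exact absurd hadj (G.irrefl))
  rw [Finset.card_singleton] at h7
  omega

/-- The vertices outside of the core form a clique on `r - 1` vertices, and all of them are adjacent
to the core on the same side. -/
theorem clique_rest (h : G.IsCore k A B) (hx : G.IsSubEigenvector x lam)
    (hr : 3 ≤ r) (hrk : r ≤ 2 * k) (hlam0 : 0 ≤ lam)
    (hlam : (Fintype.card V - r + 1 : ℝ) ^ 2 - 1 ≤ 4 * lam ^ 2)
    (hchi : ∀ N, G.Colorable N → r ≤ N) :
    (rest A B).card = r - 1 ∧ (∀ z ∈ rest A B, ∀ z' ∈ rest A B, z ≠ z' → G.Adj z z') ∧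
      ((∀ z ∈ rest A B, 0 < G.degreeIn z A) ∨ (∀ z ∈ rest A B, 0 < G.degreeIn z B)) ∧
      (∀ z ∈ rest A B, G.degreeIn z A + G.degreeIn z B ≤ 1) := by
  classical
  have hearA := fun {w w' a a'} => h.not_ear hx hr hrk hlam0 hlam hchi (w := w) (w' := w')
    (a := a) (a' := a')
  have hearB := fun {w w' a a'} => h.symm.not_ear hx hr hrk hlam0 hlam hchi (w := w) (w' := w')
    (a := a) (a' := a')
  rw [rest_comm B A] at hearB
  have hcount := h.card_restLow_add_le hx (by omega) hrk hlam0 hlam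
    (fun a _ => degreeIn_le_card a A) (fun a _ => degreeIn_le_card a B) (e := 0) (by omega)
  have hsum := card_restLow_add_card_restHigh (G := G) (A := A) (B := B)
  let c : V → Bool := fun v => decide (0 < G.degreeIn v A)
  have hcA : ∀ w, 0 < G.degreeIn w A → c w = true := fun w hw => by simpa [c] using hw
  have hcB : ∀ w, 0 < G.degreeIn w B → c w = false := fun w hw => by
    have := h.degreeIn_eq_zero_or w
    simp only [c, decide_eq_false_iff_not]
    omega
  -- A high vertex has two neighbours on its side, so one differs from any given neighbour of `w'`;
  -- attachment to the same side would contradict `not_ear`.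
  have hhigh : ∀ w ∈ restHigh G A B, ∀ w' ∈ rest A B, G.Adj w w' →
      (0 < G.degreeIn w' A → c w = false) ∧ (0 < G.degreeIn w' B → c w = true) := by
    intro w hw w' hw' hadj
    rw [mem_restHigh] at hw
    have h0 := h.degreeIn_eq_zero_or w
    constructor
    · intro hA
      by_contra hc
      have hpos : 0 < G.degreeIn w A := by simpa [c, Nat.pos_iff_ne_zero] using hc
      obtain ⟨a', ha', hwa'⟩ := degreeIn_pos_iff.mp hA
      obtain ⟨a, ha, hwa, hne⟩ := exists_adj_ne_of_two_le_degreeIn (c := a')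
        (by omega : 2 ≤ G.degreeIn w A)
      exact hne (hearA hw.1 hw' ha ha' hadj hwa hwa')
    · intro hB
      by_contra hc
      have hpos : G.degreeIn w A = 0 := by simpa [c] using hc
      obtain ⟨a', ha', hwa'⟩ := degreeIn_pos_iff.mp hB
      obtain ⟨a, ha, hwa, hne⟩ := exists_adj_ne_of_two_le_degreeIn (c := a')
        (by omega : 2 ≤ G.degreeIn w B)
      exact hne (hearB hw.1 hw' ha ha' hadj hwa hwa')
  have hmemHigh : ∀ w ∈ rest A B, w ∉ restLow G A B → w ∈ restHigh G A B := by
    intro w hw hw'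
    rw [mem_restLow] at hw'
    rw [mem_restHigh]
    tauto
  have hhh : ∀ w ∈ restHigh G A B, ∀ w' ∈ restHigh G A B, G.Adj w w' → c w ≠ c w' := by
    intro w hw w' hw' hadj
    have hw2 := mem_restHigh.mp hw'
    obtain ⟨h1, h2⟩ := hhigh w hw w' hw2.1 hadj
    rcases (by omega : 0 < G.degreeIn w' A ∨ 0 < G.degreeIn w' B) with hpos | hpos
    · rw [h1 hpos, hcA w' hpos]
      simp
    · rw [h2 hpos, hcB w' hpos]
      simp
  have hlow : r ≤ (restLow G A B).card + 2 :=
    h.le_card_add_two hchi (restLow G A B) c (fun w _ _ => hcA w) (fun w _ _ => hcB w)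
      fun w hw w' hw' h1 h2 => hhh w (hmemHigh w hw h1) w' (hmemHigh w' hw' h2)
  -- Otherwise there are `r - 2` low vertices, and the count leaves at most one high vertex. Then
  -- some low `w` can also be 2-coloured, leaving only `r - 3` extra colours: too few.
  have hlow' : (restLow G A B).card = r - 1 := by
    by_contra hne
    have hcard : (restLow G A B).card = r - 2 := by omega
    have hcardH : (restHigh G A B).card ≤ 1 := by omega
    obtain ⟨w, hw⟩ : (restLow G A B).Nonempty := Finset.card_pos.mp (by omega)
    have hw2 := mem_restLow.mp hw
    have hmem : ∀ v ∈ rest A B, v ∉ (restLow G A B).erase w → v = w ∨ v ∈ restHigh G A B := by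
      intro v hv hv'
      by_cases hvw : v = w
      · exact Or.inl hvw
      · exact Or.inr (hmemHigh v hv fun hc => hv' (Finset.mem_erase.mpr ⟨hvw, hc⟩))
    have key : ∀ f : V → Bool, (∀ v, v ≠ w → f v = c v) →
        (0 < G.degreeIn w A → f w = true) → (0 < G.degreeIn w B → f w = false) →
        (∀ z ∈ restHigh G A B, G.Adj w z → f w ≠ c z) → False := by
      intro f hfv hfA hfB hfz
      have hne : ∀ z ∈ restHigh G A B, z ≠ w := by
        rintro z hz rfl
        exact (mem_restHigh.mp hz).2 hw2.2
      have := h.le_card_add_two hchi ((restLow G A B).erase w) f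
        (by
          intro v _ _ hpos
          by_cases hvw : v = w
          · subst hvw
            exact hfA hpos
          · rw [hfv v hvw]
            exact hcA v hpos)
        (by
          intro v _ _ hpos
          by_cases hvw : v = w
          · subst hvw
            exact hfB hpos
          · rw [hfv v hvw]
            exact hcB v hpos)
        (by
          intro v hv v' hv' h1 h2 hadj
          rcases hmem v hv h1 with rfl | hz <;> rcases hmem v' hv' h2 with rfl | hz'
          · exact absurd hadj G.irrefl
          · rw [hfv v' (hne v' hz')]
            exact hfz v' hz' hadj
          · rw [hfv v (hne v hz)]
            exact (hfz v hz hadj.symm).symm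
          · rw [hfv v (hne v hz), hfv v' (hne v' hz')]
            exact hhh v hz v' hz' hadj)
      rw [Finset.card_erase_of_mem hw] at this
      omega
    by_cases hz : ∃ z ∈ restHigh G A B, G.Adj w z
    · obtain ⟨z, hz, hwz⟩ := hz
      have huniq : ∀ z' ∈ restHigh G A B, z' = z := fun z' hz' =>
        Finset.card_le_one.mp hcardH z' hz' z hz
      obtain ⟨h1, h2⟩ := hhigh z hz w hw2.1 hwz.symm
      -- Give `w` the colour opposite to the unique high vertex `z`; by `hhigh` this agrees with the
      -- side to which `w` is attached, if any.
      refine key (Function.update c w (!c z)) (fun v hv => by simp [hv]) ?_ ?_ ?_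
      · intro hpos
        simp [h1 hpos]
      · intro hpos
        simp [h2 hpos]
      · intro z' hz' _
        rw [huniq z' hz']
        simp
    · push Not at hz
      exact key c (fun _ _ => rfl) (hcA w) (hcB w) fun z hz1 hz2 => absurd hz2 (hz z hz1)
  have hHigh0 : (restHigh G A B).card = 0 := by omega
  have hcard : (rest A B).card = r - 1 := by omega
  -- No two outside vertices can be 2-coloured together with the core, since the other `r - 3` would
  -- need only `r - 3` extra colours.
  have pair : ∀ z ∈ rest A B, ∀ z' ∈ rest A B, z ≠ z' → ∀ f : V → Bool,
      (∀ v ∈ rest A B, v = z ∨ v = z' → (0 < G.degreeIn v A → f v = true) ∧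
        (0 < G.degreeIn v B → f v = false)) → (G.Adj z z' → f z ≠ f z') → False := by
    intro z hz z' hz' hne f hf hff
    have hmem : ∀ v ∈ rest A B, v ∉ ((rest A B).erase z).erase z' → v = z ∨ v = z' := by
      intro v hv hv'
      simp only [Finset.mem_erase] at hv'
      tauto
    have := h.le_card_add_two hchi (((rest A B).erase z).erase z') f
      (fun v hv hvT => (hf v hv (hmem v hv hvT)).1) (fun v hv hvT => (hf v hv (hmem v hv hvT)).2)
      (by
        intro v hv v' hv' h1 h2 hadj
        rcases hmem v hv h1 with rfl | rfl <;> rcases hmem v' hv' h2 with rfl | rfl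
        · exact absurd hadj G.irrefl
        · exact hff hadj
        · exact (hff hadj.symm).symm
        · exact absurd hadj G.irrefl)
    rw [Finset.card_erase_of_mem (Finset.mem_erase.mpr ⟨hne.symm, hz'⟩),
      Finset.card_erase_of_mem hz] at this
    omega
  have hclique : ∀ z ∈ rest A B, ∀ z' ∈ rest A B, z ≠ z' → G.Adj z z' := by
    intro z hz z' hz' hne
    by_contra hadj
    exact pair z hz z' hz' hne c (fun v _ _ => ⟨hcA v, hcB v⟩) fun hc => absurd hc hadj
  have hside : ∀ z ∈ rest A B, ∀ z' ∈ rest A B, z ≠ z' →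
      0 < G.degreeIn z A ∨ 0 < G.degreeIn z' B := by
    intro z hz z' hz' hne
    by_contra! hc
    refine pair z hz z' hz' hne (fun v => decide (v = z')) ?_ (by simp [hne])
    rintro v - (rfl | rfl)
    · simp only [hne, decide_false, implies_true, and_true]
      omega
    · simp only [decide_true, implies_true, true_and]
      omega
  refine ⟨hcard, hclique, ?_, ?_⟩
  · by_contra! hc
    obtain ⟨⟨z, hz, hzA⟩, ⟨z', hz', hzB⟩⟩ := hc
    have hzA' : ∀ y ∈ rest A B, y ≠ z → 0 < G.degreeIn y B := fun y hy hne =>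
      (hside z hz y hy hne.symm).resolve_left (by omega)
    have hzB' : ∀ y ∈ rest A B, y ≠ z' → 0 < G.degreeIn y A := fun y hy hne =>
      (hside y hy z' hz' hne).resolve_right (by omega)
    have hzz : z = z' := by
      by_contra hne
      have := hzA' z' hz' (Ne.symm hne)
      omega
    subst hzz
    -- As `r ≥ 3` there is a second outside vertex, which would be attached to both sides.
    obtain ⟨y, hy, hyz⟩ := Finset.exists_mem_ne (by omega : 1 < (rest A B).card) z
    have h1 := hzA' y hy hyz
    have h2 := hzB' y hy hyz
    have := h.degreeIn_eq_zero_or y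
    omega
  · intro z hz
    by_contra hc
    have := mem_restHigh.mpr ⟨hz, hc⟩
    rw [Finset.card_eq_zero] at hHigh0
    rw [hHigh0] at this
    simp at this

/-- The structure of the graph: a bipartite graph on `A ∪ B` and a clique which contains exactly
one vertex `a` of `A ∪ B`. -/
theorem exists_adj_rest_iff (h : G.IsCore k A B) (hx : G.IsSubEigenvector x lam)
    (hr : 3 ≤ r) (hrk : r ≤ 2 * k) (hlam0 : 0 ≤ lam)
    (hlam : (Fintype.card V - r + 1 : ℝ) ^ 2 - 1 ≤ 4 * lam ^ 2)
    (hchi : ∀ N, G.Colorable N → r ≤ N) :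
    ∃ A B : Finset V, G.IsCore k A B ∧ (rest A B).card = r - 1 ∧ ∃ a ∈ A, ∀ z ∈ rest A B, ∀ v,
      G.Adj z v ↔ v = a ∨ (v ∈ rest A B ∧ v ≠ z) := by
  obtain ⟨hcard, hclique, hside, hone⟩ := h.clique_rest hx hr hrk hlam0 hlam hchi
  wlog hA : ∀ z ∈ rest A B, 0 < G.degreeIn z A generalizing A B
  · refine this h.symm (by rwa [rest_comm]) (by rwa [rest_comm])
      (by rw [rest_comm]; exact hside.symm)
      (by rw [rest_comm]; intro z hz; rw [add_comm]; exact hone z hz)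
      (by rw [rest_comm]; exact hside.resolve_left hA)
  obtain ⟨z₀, hz₀⟩ : (rest A B).Nonempty := Finset.card_pos.mp (by omega)
  obtain ⟨a, ha, hza⟩ := degreeIn_pos_iff.mp (hA z₀ hz₀)
  have hall : ∀ z ∈ rest A B, G.Adj z a := by
    intro z hz
    by_cases hzz : z = z₀
    · exact hzz ▸ hza
    obtain ⟨a', ha', hza'⟩ := degreeIn_pos_iff.mp (hA z hz)
    exact h.not_ear hx hr hrk hlam0 hlam hchi hz hz₀ ha' ha (hclique z hz z₀ hz₀ hzz) hza' hza
      ▸ hza'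
  refine ⟨A, B, h, hcard, a, ha, fun z hz v => ⟨fun hzv => ?_, ?_⟩⟩
  · by_cases hv : v ∈ rest A B
    · exact Or.inr ⟨hv, hzv.ne'⟩
    have hvB : v ∉ B := fun hc => h.one_side z a ha v hc (hall z hz) hzv
    have hvA : v ∈ A := by
      by_contra hc
      exact hv (mem_rest.mpr ⟨hc, hvB⟩)
    left
    by_contra hne
    have h1 := hone z hz
    have h2 := hA z hz
    classical
    have h3 : ({v, a} : Finset V).card ≤ G.degreeIn z A := by
      rw [degreeIn]
      refine Finset.card_le_card ?_
      intro y hy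
      rw [Finset.mem_insert, Finset.mem_singleton] at hy
      rw [Finset.mem_filter]
      rcases hy with rfl | rfl
      · exact ⟨hvA, hzv⟩
      · exact ⟨ha, hall z hz⟩
    rw [Finset.card_pair hne] at h3
    omega
  · rintro (rfl | ⟨hv, hne⟩)
    · exact hall z hz
    · exact hclique z hz v hv hne.symm

end IsCore

end SimpleGraph

/-! ### The spectral radius and (sub)eigenvectors. -/

namespace SimpleGraph

variable {V W : Type*} [Fintype V] [Fintype W]

theorem adjSpectralRadius_eq (G : SimpleGraph V) [DecidableEq V] [DecidableRel G.Adj] :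
    G.adjSpectralRadius = spectralRadius ℂ (G.adjMatrix ℂ) := by
  unfold adjSpectralRadius
  congr!

theorem adjSpectralRadius_congr {G : SimpleGraph V} {H : SimpleGraph W} (e : G ≃g H) :
    G.adjSpectralRadius = H.adjSpectralRadius := by
  classical
  rw [adjSpectralRadius_eq, adjSpectralRadius_eq, spectralRadius, spectralRadius]
  have h1 : G.adjMatrix ℂ = Matrix.reindexAlgEquiv ℂ ℂ e.toEquiv.symm (H.adjMatrix ℂ) := by
    ext u v
    simp [adjMatrix_apply, e.map_adj_iff]
  rw [h1, AlgEquiv.spectrum_eq]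

/-- Taking moduli in the equation of an eigenvector of maximal modulus, the triangle inequality
gives the claim without Perron–Frobenius. -/
theorem exists_isSubEigenvector [Nonempty V] (G : SimpleGraph V) :
    ∃ lam : ℝ, 0 ≤ lam ∧ G.adjSpectralRadius = ENNReal.ofReal lam ∧
      ∃ x, G.IsSubEigenvector x lam := by
  classical
  let _ := Matrix.linftyOpNormedRing (n := V) (α := ℂ)
  let _ := Matrix.linftyOpNormedAlgebra (R := ℂ) (n := V) (α := ℂ)
  obtain ⟨μ, hμ, hμr⟩ := spectrum.exists_nnnorm_eq_spectralRadius (G.adjMatrix ℂ)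
  rw [← Matrix.spectrum_toLin', ← Module.End.hasEigenvalue_iff_mem_spectrum] at hμ
  obtain ⟨y, hy⟩ := hμ.exists_hasEigenvector
  have hy1 := hy.apply_eq_smul
  have hy0 := hy.2
  refine ⟨‖μ‖, norm_nonneg _, ?_, fun v => ‖y v‖, fun v => norm_nonneg _, ?_, fun v => ?_⟩
  · rw [adjSpectralRadius_eq, ← hμr, ofReal_norm]
    rfl
  · obtain ⟨v, hv⟩ := Function.ne_iff.mp hy0
    exact ⟨v, norm_pos_iff.mpr hv⟩
  · have h1 := congrFun hy1 v
    rw [Matrix.toLin'_apply] at h1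
    rw [← norm_mul]
    have h2 : μ * y v = ∑ w, if G.Adj v w then y w else 0 := by
      rw [Pi.smul_apply, smul_eq_mul] at h1
      rw [← h1, Matrix.mulVec, dotProduct]
      refine Finset.sum_congr rfl fun w _ => ?_
      simp [adjMatrix_apply]
    rw [h2, weightIn_eq_sum]
    refine (norm_sum_le _ _).trans (le_of_eq (Finset.sum_congr rfl fun w _ => ?_))
    split_ifs <;> simp

theorem ofReal_le_adjSpectralRadius {G : SimpleGraph V} {x : V → ℝ} {lam : ℝ}
    (hx : ∃ v, x v ≠ 0) (h : ∀ v, G.weightIn x v Finset.univ = lam * x v) :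
    ENNReal.ofReal lam ≤ G.adjSpectralRadius := by
  classical
  rw [adjSpectralRadius_eq]
  have hmem : (lam : ℂ) ∈ spectrum ℂ (G.adjMatrix ℂ) := by
    rw [← Matrix.spectrum_toLin', ← Module.End.hasEigenvalue_iff_mem_spectrum]
    refine Module.End.hasEigenvalue_of_hasEigenvector (x := fun v => (x v : ℂ)) ?_
    rw [Module.End.hasEigenvector_iff, Module.End.mem_eigenspace_iff]
    constructor
    · ext v
      have h1 := congrArg (fun t : ℝ => (t : ℂ)) (h v)
      rw [weightIn_eq_sum] at h1
      push_cast at h1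
      rw [Matrix.toLin'_apply, Matrix.mulVec, dotProduct, Pi.smul_apply, smul_eq_mul, ← h1]
      refine Finset.sum_congr rfl fun w _ => ?_
      simp only [adjMatrix_apply]
      split_ifs <;> simp
    · obtain ⟨v, hv⟩ := hx
      exact Function.ne_iff.mpr ⟨v, by simpa using hv⟩
  refine le_trans ?_ (le_iSup₂ (f := fun (z : ℂ) (_ : z ∈ spectrum ℂ (G.adjMatrix ℂ)) =>
    (‖z‖₊ : ℝ≥0∞)) (lam : ℂ) hmem)
  rw [← enorm_eq_nnnorm, ← ofReal_norm]
  refine ENNReal.ofReal_le_ofReal ?_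
  rw [Complex.norm_real]
  exact le_abs_self lam

end SimpleGraph

/-! ### The characteristic equation of the extremal graph. -/

/-- The excess of `lam ^ 2 / t - s` for a complete bipartite graph with a clique on `r` vertices
attached. -/
noncomputable def cliqueExcess (r : ℕ) (lam : ℝ) : ℝ :=
  (r - 1) / ((lam + 1) * (lam - r + 1))

theorem exists_sq_eq_mul_add_cliqueExcess {r s t : ℕ} (hr : 1 < r) (ht : 0 < t)
    (hst : (r : ℝ) < Real.sqrt (s * t)) :
    ∃ l : ℝ, Real.sqrt (s * t) ≤ l ∧ l ^ 2 = t * (s + cliqueExcess r l) := by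
  have hr' : (1 : ℝ) < r := by exact_mod_cast hr
  have ht' : (1 : ℝ) ≤ t := by exact_mod_cast ht
  have hs0 : (0 : ℝ) ≤ s := s.cast_nonneg
  set q := Real.sqrt (s * t) with hq
  have hq2 : q ^ 2 = s * t := Real.sq_sqrt (by positivity)
  -- The equation cleared of denominators; the root comes from the intermediate value theorem,
  -- starting at `√(st)`.
  let f : ℝ → ℝ := fun y => (y ^ 2 - s * t) * ((y + 1) * (y - r + 1)) - t * (r - 1)
  have hcont : ContinuousOn f (Set.Icc q (q + t * r)) := by
    apply Continuous.continuousOn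
    fun_prop
  have h0 : f q ≤ 0 := by
    have : f q = - (t * (r - 1)) := by
      simp only [f]
      rw [hq2]
      ring
    rw [this]
    nlinarith
  have h1 : 0 ≤ f (q + t * r) := by
    have htr : 0 < t * (r : ℝ) := mul_pos (by linarith) (by linarith)
    have e1 : t * (r : ℝ) ≤ (q + t * r) ^ 2 - s * t := by nlinarith
    have e2 : 1 ≤ (q + t * r + 1) * (q + t * r - r + 1) :=
      one_le_mul_of_one_le_of_one_le (by linarith) (by linarith)
    have e3 := mul_le_mul e1 e2 zero_le_one (by nlinarith)
    simp only [f]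
    nlinarith
  obtain ⟨l, hl, hfl⟩ := intermediate_value_Icc (by nlinarith) hcont ⟨h0, h1⟩
  refine ⟨l, hl.1, ?_⟩
  have hpos : 0 < (l + 1) * (l - r + 1) := mul_pos (by linarith [hl.1]) (by linarith [hl.1])
  simp only [f] at hfl
  rw [cliqueExcess]
  have h2 : l ^ 2 - s * t = t * (r - 1) / ((l + 1) * (l - r + 1)) := by
    rw [eq_div_iff hpos.ne']
    linarith
  rw [mul_add, ← mul_div_assoc, ← h2]
  ring

theorem cliqueExcess_pos {r : ℕ} {lam : ℝ} (hr : 1 < r) (h : (r : ℝ) < lam) :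
    0 < cliqueExcess r lam := by
  have hr' : (1 : ℝ) < r := by exact_mod_cast hr
  exact div_pos (by linarith) (mul_pos (by linarith) (by linarith))

theorem cliqueExcess_lt_one {r : ℕ} {lam : ℝ} (hr : 1 < r) (h : (r : ℝ) < lam) :
    cliqueExcess r lam < 1 := by
  have hr' : (1 : ℝ) < r := by exact_mod_cast hr
  rw [cliqueExcess, div_lt_one (mul_pos (by linarith) (by linarith))]
  nlinarith

theorem cliqueExcess_le {r : ℕ} {l lam : ℝ} (hr : 1 < r) (h : (r : ℝ) < l) (hl : l ≤ lam) :
    cliqueExcess r lam ≤ cliqueExcess r l := by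
  have hr' : (1 : ℝ) < r := by exact_mod_cast hr
  refine div_le_div_of_nonneg_left (by linarith) (mul_pos (by linarith) (by linarith)) ?_
  apply mul_le_mul <;> linarith

/-- `t * (s + κ)` with fixed `s + t` and `0 < κ < 1` is largest for `s = ⌊m / 2⌋`. -/
theorem eq_half_of_mul_add_le {m s t : ℕ} (hst : s + t = m) {κ : ℝ} (h0 : 0 < κ) (h1 : κ < 1)
    (h : (((m + 1) / 2 : ℕ) : ℝ) * (((m / 2 : ℕ) : ℝ) + κ) ≤ t * (s + κ)) :
    s = m / 2 ∧ t = (m + 1) / 2 := by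
  obtain ⟨s', hs'⟩ : ∃ s', s' = m / 2 := ⟨_, rfl⟩
  obtain ⟨t', ht'⟩ : ∃ t', t' = (m + 1) / 2 := ⟨_, rfl⟩
  rw [← hs', ← ht'] at h ⊢
  have e0 : s + t = s' + t' := by omega
  have e : (s + t : ℝ) = s' + t' := by exact_mod_cast e0
  -- For integers, `t < t'` gives `t ≤ s'`, excluded by `κ > 0`; `t > t'` gives `t - s' ≥ 1`,
  -- excluded by `κ < 1`.
  have hkey : ((t : ℝ) - t') * (t - s') ≤ (t - t') * κ := by
    have : (s : ℝ) = s' + t' - t := by linarith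
    rw [this] at h
    linarith
  suffices t = t' by omega
  rcases lt_trichotomy t t' with hlt | heq | hgt
  · exfalso
    have c1 : (t : ℝ) < t' := by exact_mod_cast hlt
    have c2 : (t : ℝ) ≤ s' := by exact_mod_cast (by omega : t ≤ s')
    nlinarith
  · exact heq
  · exfalso
    have c1 : (t' : ℝ) + 1 ≤ t := by exact_mod_cast hgt
    have c2 : (s' : ℝ) + 1 ≤ t := by exact_mod_cast (by omega : s' + 1 ≤ t)
    nlinarith

section turanIdentifyClique

variable {n r : ℕ} {hr : 1 ≤ r} {hn : r < n}

@[simp]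
theorem turanIdentifyClique_adj_left_left (i j : Fin ((n - r + 1) / 2)) :
    ¬ (turanIdentifyClique n r hr hn).Adj (.inl (.inl i)) (.inl (.inl j)) := by
  change ¬ (bipartiteTuranGraph (n - r + 1)).Adj (.inl i) (.inl j)
  simp [bipartiteTuranGraph]

@[simp]
theorem turanIdentifyClique_adj_right_right (i j : Fin ((n - r + 1 + 1) / 2)) :
    ¬ (turanIdentifyClique n r hr hn).Adj (.inl (.inr i)) (.inl (.inr j)) := by
  change ¬ (bipartiteTuranGraph (n - r + 1)).Adj (.inr i) (.inr j)
  simp [bipartiteTuranGraph]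

@[simp]
theorem turanIdentifyClique_adj_left_right (i : Fin ((n - r + 1) / 2))
    (j : Fin ((n - r + 1 + 1) / 2)) :
    (turanIdentifyClique n r hr hn).Adj (.inl (.inl i)) (.inl (.inr j)) := by
  change (bipartiteTuranGraph (n - r + 1)).Adj (.inl i) (.inr j)
  simp [bipartiteTuranGraph]

@[simp]
theorem turanIdentifyClique_adj_right_left (i : Fin ((n - r + 1) / 2))
    (j : Fin ((n - r + 1 + 1) / 2)) :
    (turanIdentifyClique n r hr hn).Adj (.inl (.inr j)) (.inl (.inl i)) :=
  (turanIdentifyClique_adj_left_right i j).symm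

@[simp]
theorem turanIdentifyClique_adj_left_clique (i : Fin ((n - r + 1) / 2))
    (w : {w : Fin r // w ≠ ⟨0, hr⟩}) :
    (turanIdentifyClique n r hr hn).Adj (.inl (.inl i)) (.inr w) ↔ i = ⟨0, by omega⟩ := by
  change (Sum.inl i = Sum.inl _ ∧ (⊤ : SimpleGraph (Fin r)).Adj _ _) ↔ _
  simp [w.2.symm]

@[simp]
theorem turanIdentifyClique_adj_clique_left (i : Fin ((n - r + 1) / 2))
    (w : {w : Fin r // w ≠ ⟨0, hr⟩}) :
    (turanIdentifyClique n r hr hn).Adj (.inr w) (.inl (.inl i)) ↔ i = ⟨0, by omega⟩ := by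
  rw [SimpleGraph.adj_comm, turanIdentifyClique_adj_left_clique]

@[simp]
theorem turanIdentifyClique_adj_right_clique (j : Fin ((n - r + 1 + 1) / 2))
    (w : {w : Fin r // w ≠ ⟨0, hr⟩}) :
    ¬ (turanIdentifyClique n r hr hn).Adj (.inl (.inr j)) (.inr w) := by
  change ¬ (Sum.inr j = Sum.inl _ ∧ (⊤ : SimpleGraph (Fin r)).Adj _ _)
  simp

@[simp]
theorem turanIdentifyClique_adj_clique_right (j : Fin ((n - r + 1 + 1) / 2))
    (w : {w : Fin r // w ≠ ⟨0, hr⟩}) :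
    ¬ (turanIdentifyClique n r hr hn).Adj (.inr w) (.inl (.inr j)) := by
  rw [SimpleGraph.adj_comm]
  exact turanIdentifyClique_adj_right_clique j w

@[simp]
theorem turanIdentifyClique_adj_clique_clique (w z : {w : Fin r // w ≠ ⟨0, hr⟩}) :
    (turanIdentifyClique n r hr hn).Adj (.inr w) (.inr z) ↔ w ≠ z := by
  change (⊤ : SimpleGraph (Fin r)).Adj _ _ ↔ _
  simp [Subtype.ext_iff]

variable (x : (Fin ((n - r + 1) / 2) ⊕ Fin ((n - r + 1 + 1) / 2)) ⊕ {w : Fin r // w ≠ ⟨0, hr⟩} → ℝ)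

theorem weightIn_turanIdentifyClique_left (i : Fin ((n - r + 1) / 2)) :
    (turanIdentifyClique n r hr hn).weightIn x (.inl (.inl i)) Finset.univ =
      ∑ j, x (.inl (.inr j)) + if i = ⟨0, by omega⟩ then ∑ w, x (.inr w) else 0 := by
  classical
  rw [SimpleGraph.weightIn_eq_sum, Fintype.sum_sum_type, Fintype.sum_sum_type]
  split_ifs with h <;> simp [h]

theorem weightIn_turanIdentifyClique_right (j : Fin ((n - r + 1 + 1) / 2)) :
    (turanIdentifyClique n r hr hn).weightIn x (.inl (.inr j)) Finset.univ =
      ∑ i, x (.inl (.inl i)) := by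
  classical
  rw [SimpleGraph.weightIn_eq_sum, Fintype.sum_sum_type, Fintype.sum_sum_type]
  simp

theorem weightIn_turanIdentifyClique_clique (w : {w : Fin r // w ≠ ⟨0, hr⟩}) :
    (turanIdentifyClique n r hr hn).weightIn x (.inr w) Finset.univ =
      x (.inl (.inl ⟨0, by omega⟩)) + (∑ z, x (.inr z) - x (.inr w)) := by
  classical
  rw [SimpleGraph.weightIn_eq_sum, Fintype.sum_sum_type, Fintype.sum_sum_type]
  have h : ∑ z, (if (turanIdentifyClique n r hr hn).Adj (.inr w) (.inr z) then x (.inr z) else 0) =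
      ∑ z, x (.inr z) - x (.inr w) := by
    rw [← Finset.add_sum_erase _ (fun z => x (.inr z)) (Finset.mem_univ w),
      ← Finset.add_sum_erase _ _ (Finset.mem_univ w), if_neg (SimpleGraph.irrefl _),
      Finset.sum_congr rfl (fun z hz => if_pos ((turanIdentifyClique_adj_clique_clique w z).mpr
        (Finset.ne_of_mem_erase hz).symm))]
    ring
  rw [h]
  simp

theorem ofReal_le_adjSpectralRadius_turanIdentifyClique {l : ℝ} (hl : (r : ℝ) < l)
    (h : l ^ 2 = ((n - r + 1 + 1) / 2 : ℕ) * (((n - r + 1) / 2 : ℕ) + cliqueExcess r l)) :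
    ENNReal.ofReal l ≤ (turanIdentifyClique n r hr hn).adjSpectralRadius := by
  classical
  have hr' : (1 : ℝ) ≤ r := by exact_mod_cast hr
  obtain ⟨s, hs⟩ : ∃ s, s = (n - r + 1) / 2 := ⟨_, rfl⟩
  obtain ⟨t, ht⟩ : ∃ t, t = (n - r + 1 + 1) / 2 := ⟨_, rfl⟩
  have hs0 : 0 < s := by omega
  have ht0 : (0 : ℝ) < t := by exact_mod_cast (by omega : 0 < t)
  have hE : 0 < (l + 1) * (l - r + 1) := mul_pos (by linarith) (by linarith)
  obtain ⟨E, hEdef⟩ : ∃ E, E = (l + 1) * (l - r + 1) := ⟨_, rfl⟩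
  rw [← hEdef] at hE
  have hkey : l ^ 2 * E = t * (s * E + (r - 1)) := by
    rw [h, cliqueExcess, ← hEdef, ← hs, ← ht]
    field_simp
  have hl0 : 0 < l := by linarith
  let i₀ : Fin ((n - r + 1) / 2) := ⟨0, by omega⟩
  -- The eigenvector, normalised to 1 on the clique: its equation there gives `l - r + 2` at the
  -- shared vertex, whose own equation makes the total on the right part `E`.
  let x : (Fin ((n - r + 1) / 2) ⊕ Fin ((n - r + 1 + 1) / 2)) ⊕ {w : Fin r // w ≠ ⟨0, hr⟩} → ℝ :=
    Sum.elim (Sum.elim (fun i => if i = i₀ then l - r + 2 else E / l) (fun _ => E / t))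
      (fun _ => 1)
  have hsumW : ∑ w, x (.inr w) = r - 1 := by
    simp only [x, Sum.elim_inr, Finset.sum_const, Finset.card_univ]
    rw [Fintype.card_subtype_compl, Fintype.card_fin, Fintype.card_subtype_eq, nsmul_eq_mul,
      Nat.cast_sub hr]
    simp
  have hsumB : ∑ j, x (.inl (.inr j)) = E := by
    simp only [x, Sum.elim_inl, Sum.elim_inr, Finset.sum_const, Finset.card_univ, Fintype.card_fin,
      nsmul_eq_mul, ← ht]
    field_simp
  have hsumA : ∑ i, x (.inl (.inl i)) = (s - 1) * (E / l) + (l - r + 2) := by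
    simp only [x, Sum.elim_inl]
    rw [← Finset.add_sum_erase _ _ (Finset.mem_univ i₀), if_pos rfl,
      Finset.sum_congr rfl (fun i hi => if_neg (Finset.ne_of_mem_erase hi)), Finset.sum_const,
      Finset.card_erase_of_mem (Finset.mem_univ _), Finset.card_univ, Fintype.card_fin, ← hs,
      nsmul_eq_mul, Nat.cast_sub hs0]
    push_cast
    ring
  refine SimpleGraph.ofReal_le_adjSpectralRadius (x := x) ⟨.inl (.inr ⟨0, by omega⟩), ?_⟩ ?_
  · simp only [x, Sum.elim_inl, Sum.elim_inr]
    positivity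
  · rintro ((i | j) | w)
    · rw [weightIn_turanIdentifyClique_left, hsumB, hsumW]
      simp only [x, Sum.elim_inl]
      by_cases hi : i = i₀
      · rw [if_pos hi, if_pos hi, hEdef]
        ring
      · rw [if_neg hi, if_neg hi]
        field_simp
        ring
    · rw [weightIn_turanIdentifyClique_right, hsumA]
      simp only [x, Sum.elim_inl, Sum.elim_inr]
      have e1 : l * (l - r + 2) = E + (r - 1) := by rw [hEdef]; ring
      field_simp
      linear_combination (-1 : ℝ) * hkey + t * e1
    · rw [weightIn_turanIdentifyClique_clique, hsumW]
      simp only [x, Sum.elim_inl, Sum.elim_inr]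
      rw [if_pos rfl]
      ring

end turanIdentifyClique

/-! ### Optimising the parts, and the case of equality. -/

namespace SimpleGraph

variable {V : Type*} [Fintype V] {G : SimpleGraph V}

namespace IsCore

variable {k r : ℕ} {A B : Finset V} {a : V} {x : V → ℝ} {lam : ℝ}

/-- The eigenvalue inequalities for a bipartite graph with a clique attached at `a`. -/
theorem sums_le (h : G.IsCore k A B) (hx : G.IsSubEigenvector x lam) (hr : 1 < r)
    (hlam : (r : ℝ) < lam) (hcard : (rest A B).card = r - 1) (ha : a ∈ A)
    (hadj : ∀ z ∈ rest A B, ∀ v, G.Adj z v ↔ v = a ∨ (v ∈ rest A B ∧ v ≠ z)) :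
    lam * ∑ b ∈ B, x b ≤ ∑ v ∈ A, G.degreeIn v B * x v ∧
    (∑ w ∈ rest A B, x w) ≤ cliqueExcess r lam * ∑ b ∈ B, x b ∧
    (∀ v ∈ A, v ≠ a → lam * x v ≤ ∑ b ∈ B, x b) ∧
    lam * x a ≤ ∑ b ∈ B, x b + ∑ w ∈ rest A B, x w := by
  classical
  have haZ : a ∉ rest A B := fun hc => (mem_rest.mp hc).1 ha
  have hr' : (1 : ℝ) < r := by exact_mod_cast hr
  have hB : lam * ∑ b ∈ B, x b ≤ ∑ v ∈ A, G.degreeIn v B * x v := by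
    rw [Finset.mul_sum, ← sum_weightIn_eq]
    refine Finset.sum_le_sum fun b hb => ?_
    have h1 := hx.mul_le b
    rw [h.weightIn_univ, weightIn_eq_zero (h.not_adj_right b hb), weightIn_eq_zero (S := rest A B)]
      at h1
    · linarith
    · intro w hw hbw
      rcases (hadj w hw b).mp hbw.symm with rfl | hc
      · exact Finset.disjoint_left.mp h.disjoint ha hb
      · exact (mem_rest.mp hc.1).2 hb
  have hA : ∀ v ∈ A, v ≠ a → lam * x v ≤ ∑ b ∈ B, x b := by
    intro v hv hva
    have h1 := hx.mul_le v
    rw [h.weightIn_univ, weightIn_eq_zero (h.not_adj_left v hv), weightIn_eq_zero (S := rest A B)]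
      at h1
    · linarith [weightIn_le_sum (G := G) hx.nonneg v B]
    · intro w hw hvw
      rcases (hadj w hw v).mp hvw.symm with hc | hc
      · exact hva hc
      · exact (mem_rest.mp hc.1).1 hv
  have ha' : lam * x a ≤ ∑ b ∈ B, x b + ∑ w ∈ rest A B, x w := by
    have h1 := hx.mul_le a
    rw [h.weightIn_univ, weightIn_eq_zero (h.not_adj_left a ha)] at h1
    linarith [weightIn_le_sum (G := G) hx.nonneg a B,
      weightIn_le_sum (G := G) hx.nonneg a (rest A B)]
  have hZ : lam * ∑ w ∈ rest A B, x w ≤ (r - 1) * x a + (r - 2) * ∑ w ∈ rest A B, x w := by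
    have h1 : ∀ z ∈ rest A B, lam * x z ≤ x a + (∑ w ∈ rest A B, x w - x z) := by
      intro z hz
      refine (hx.mul_le z).trans (le_of_eq ?_)
      have : Finset.univ.filter (G.Adj z) = insert a ((rest A B).erase z) := by
        ext v
        rw [Finset.mem_filter, Finset.mem_insert, Finset.mem_erase, hadj z hz v]
        simp [and_comm]
      rw [weightIn, ← Finset.add_sum_erase _ _ hz]
      have h2 : ∑ w ∈ Finset.univ.filter (G.Adj z), x w = x a + ∑ w ∈ (rest A B).erase z, x w := by
        rw [this, Finset.sum_insert (fun hc => haZ (Finset.mem_of_mem_erase hc))]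
      rw [add_sub_cancel_left, ← h2]
    have h2 := Finset.sum_le_sum h1
    rw [← Finset.mul_sum, Finset.sum_add_distrib, Finset.sum_sub_distrib, Finset.sum_const,
      Finset.sum_const, hcard, nsmul_eq_mul, nsmul_eq_mul, Nat.cast_sub hr.le] at h2
    push_cast at h2
    linarith
  refine ⟨hB, ?_, hA, ha'⟩
  set ζ := ∑ w ∈ rest A B, x w
  set σ := ∑ b ∈ B, x b
  -- Eliminating `x a` produces `λ² - (r - 2)λ - (r - 1) = (λ + 1)(λ - r + 1)`, the denominator of
  -- `cliqueExcess`.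
  rw [cliqueExcess, div_mul_eq_mul_div, le_div_iff₀ (mul_pos (by linarith) (by linarith))]
  have h1 : (r - 1) * (lam * x a) ≤ (r - 1) * (σ + ζ) :=
    mul_le_mul_of_nonneg_left ha' (by linarith)
  have h2 : lam * (lam * ζ) ≤ lam * ((r - 1) * x a + (r - 2) * ζ) :=
    mul_le_mul_of_nonneg_left hZ (by linarith)
  linarith

/-- Combine `λσ_A ≤ (|A| + κ)σ_B` with `λσ_B ≤ |B|σ_A`. In case of equality, a non-edge at `v ∈ A`
forces `x v = 0`; then `v` adds nothing to `σ_A`, and the bound holds with `|A| - 1`, a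
contradiction. -/
theorem sq_le (h : G.IsCore k A B) (hx : G.IsSubEigenvector x lam) (hr : 1 < r)
    (hlam : (r : ℝ) < lam) (hlam' : (Fintype.card V - 2 * k : ℝ) / 2 ≤ lam)
    (hcard : (rest A B).card = r - 1) (ha : a ∈ A)
    (hadj : ∀ z ∈ rest A B, ∀ v, G.Adj z v ↔ v = a ∨ (v ∈ rest A B ∧ v ≠ z)) :
    lam ^ 2 ≤ B.card * (A.card + cliqueExcess r lam) ∧
      (lam ^ 2 = B.card * (A.card + cliqueExcess r lam) → ∀ v ∈ A, ∀ b ∈ B, G.Adj v b) := by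
  classical
  obtain ⟨h1, h2, h3, h4⟩ := h.sums_le hx hr hlam hcard ha hadj
  obtain ⟨u, hM, hu⟩ := hx.exists_max
  have hN := h.cast_le_card
  have hk := h.two_le_cast
  have hσ : 0 < ∑ b ∈ B, x b :=
    (mul_pos (mul_pos (by norm_num) (by linarith)) hu).trans_le (h.le_sum hx hlam' hM hu).1
  have hκ := cliqueExcess_pos hr hlam
  have hr' : (1 : ℝ) < r := by exact_mod_cast hr
  set σ := ∑ b ∈ B, x b
  set ζ := ∑ w ∈ rest A B, x w
  set κ := cliqueExcess r lam
  have hA : lam * ∑ v ∈ A, x v ≤ (A.card + κ) * σ := by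
    rw [← Finset.add_sum_erase _ _ ha, mul_add, Finset.mul_sum]
    have e1 : ∑ v ∈ A.erase a, lam * x v ≤ (A.erase a).card * σ := by
      rw [← nsmul_eq_mul]
      exact Finset.sum_le_card_nsmul _ _ _ fun v hv =>
        h3 v (Finset.mem_of_mem_erase hv) (Finset.ne_of_mem_erase hv)
    have e2 : ((A.erase a).card : ℝ) = A.card - 1 := by
      rw [Finset.card_erase_of_mem ha, Nat.cast_sub (Finset.card_pos.mpr ⟨a, ha⟩)]
      simp
    rw [e2] at e1
    linarith
  have hdeg : ∀ v, (G.degreeIn v B : ℝ) * x v ≤ B.card * x v := fun v =>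
    mul_le_mul_of_nonneg_right (by exact_mod_cast degreeIn_le_card v B) (hx.nonneg v)
  have hB0 : (0 : ℝ) ≤ B.card := Nat.cast_nonneg _
  have hlam0 : 0 < lam := by linarith
  have hgen : ∀ δ, ∑ v ∈ A, G.degreeIn v B * x v + δ ≤ B.card * ∑ v ∈ A, x v →
      lam ^ 2 * σ + lam * δ ≤ (B.card * (A.card + κ)) * σ := by
    intro δ hδ
    have e1 : lam * (lam * σ + δ) ≤ lam * (B.card * ∑ v ∈ A, x v) :=
      mul_le_mul_of_nonneg_left (by linarith) hlam0.le
    have e2 := mul_le_mul_of_nonneg_left hA hB0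
    linarith
  refine ⟨?_, ?_⟩
  · refine le_of_mul_le_mul_right ?_ hσ
    have := hgen 0 (by
      rw [add_zero, Finset.mul_sum]
      exact Finset.sum_le_sum fun v _ => hdeg v)
    linarith
  · intro heq v hv b hb
    by_contra hvb
    have hlt : (G.degreeIn v B : ℝ) + 1 ≤ B.card := by
      have : G.degreeIn v B < B.card := by
        rw [degreeIn]
        exact Finset.card_lt_card (Finset.filter_ssubset.mpr ⟨b, hb, hvb⟩)
      exact_mod_cast this
    have hx0 : x v ≤ 0 := by
      have := hgen (x v) (by
        rw [← Finset.add_sum_erase _ _ hv, Finset.mul_sum, ← Finset.add_sum_erase _ _ hv]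
        have e1 := Finset.sum_le_sum (s := A.erase v) fun w _ => hdeg w
        have e2 := mul_le_mul_of_nonneg_right hlt (hx.nonneg v)
        linarith)
      rw [heq] at this
      by_contra! hc
      linarith [mul_pos hlam0 hc]
    have hA' : lam * ∑ w ∈ A, x w ≤ (A.card - 1 + κ) * σ := by
      have e2 : ((A.erase v).card : ℝ) = A.card - 1 := by
        rw [Finset.card_erase_of_mem hv, Nat.cast_sub (Finset.card_pos.mpr ⟨v, hv⟩)]
        simp
      have e3 : lam * x v ≤ 0 := mul_nonpos_of_nonneg_of_nonpos hlam0.le hx0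
      have hζ : 0 ≤ κ * σ := (mul_pos hκ hσ).le
      have e4 : ∑ w ∈ A.erase v, lam * x w ≤ ∑ w ∈ A.erase v, (σ + if w = a then ζ else 0) := by
        refine Finset.sum_le_sum fun w hw => ?_
        split_ifs with hwa
        · rw [hwa]
          exact h4
        · rw [add_zero]
          exact h3 w (Finset.mem_of_mem_erase hw) hwa
      rw [Finset.sum_add_distrib, Finset.sum_const, nsmul_eq_mul, e2, Finset.sum_ite_eq'] at e4
      have e5 : (if a ∈ A.erase v then ζ else 0) ≤ κ * σ := by
        split_ifs
        · exact h2
        · exact hζ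
      rw [← Finset.add_sum_erase _ _ hv, mul_add, Finset.mul_sum]
      linarith
    have e6 : lam * (lam * σ) ≤ lam * (B.card * ∑ w ∈ A, x w) := by
      refine mul_le_mul_of_nonneg_left (h1.trans ?_) hlam0.le
      rw [Finset.mul_sum]
      exact Finset.sum_le_sum fun v _ => hdeg v
    have e7 := mul_le_mul_of_nonneg_left hA' hB0
    have e8 : lam ^ 2 * σ ≤ (B.card * (A.card + κ)) * σ - B.card * σ := by linarith
    rw [heq] at e8
    have hBpos : (0 : ℝ) < B.card := by exact_mod_cast Finset.card_pos.mpr ⟨b, hb⟩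
    linarith [mul_pos hBpos hσ]

/-- A complete bipartite graph with a clique attached is isomorphic to `turanIdentifyClique`. -/
theorem nonempty_iso {n : ℕ} (h : G.IsCore k A B) (hr : 1 ≤ r) (hn : r < n)
    (hA : A.card = (n - r + 1) / 2) (hB : B.card = (n - r + 1 + 1) / 2)
    (hcard : (rest A B).card = r - 1) (ha : a ∈ A)
    (hadj : ∀ z ∈ rest A B, ∀ v, G.Adj z v ↔ v = a ∨ (v ∈ rest A B ∧ v ≠ z))
    (hfull : ∀ v ∈ A, ∀ b ∈ B, G.Adj v b) : Nonempty (G ≃g turanIdentifyClique n r hr hn) := by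
  classical
  have hcardV := h.card_add_card_add_card
  have hcardW : Fintype.card {w : Fin r // w ≠ ⟨0, hr⟩} = r - 1 := by
    rw [Fintype.card_subtype_compl, Fintype.card_fin, Fintype.card_subtype_eq]
  let i₀ : Fin ((n - r + 1) / 2) := ⟨0, by omega⟩
  let eA' : Fin ((n - r + 1) / 2) ≃ A := (A.equivFinOfCardEq hA).symm
  -- The swap sends the distinguished index to `a`.
  let eA : Fin ((n - r + 1) / 2) ≃ A := (Equiv.swap i₀ (eA'.symm ⟨a, ha⟩)).trans eA'
  have eA0 : ∀ i, (eA i : V) = a ↔ i = i₀ := by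
    intro i
    have : eA i₀ = ⟨a, ha⟩ := by simp [eA]
    rw [← eA.apply_eq_iff_eq, this, Subtype.ext_iff]
  let eB : Fin ((n - r + 1 + 1) / 2) ≃ B := (B.equivFinOfCardEq hB).symm
  let eZ : {w : Fin r // w ≠ ⟨0, hr⟩} ≃ rest A B :=
    Fintype.equivOfCardEq (by rw [hcardW, Fintype.card_coe, hcard])
  let φ : (Fin ((n - r + 1) / 2) ⊕ Fin ((n - r + 1 + 1) / 2)) ⊕ {w : Fin r // w ≠ ⟨0, hr⟩} → V :=
    Sum.elim (Sum.elim (fun i => eA i) (fun j => eB j)) (fun w => eZ w)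
  have hφ : Function.Injective φ := by
    refine Function.Injective.sumElim (Function.Injective.sumElim
      (Subtype.val_injective.comp eA.injective) (Subtype.val_injective.comp eB.injective) ?_)
      (Subtype.val_injective.comp eZ.injective) ?_
    · intro i j hij
      exact Finset.disjoint_left.mp h.disjoint (eA i).2 (hij ▸ (eB j).2)
    · rintro (i | j) w hij
      · exact (mem_rest.mp (eZ w).2).1 (hij ▸ (eA i).2)
      · exact (mem_rest.mp (eZ w).2).2 (hij ▸ (eB j).2)
  have hbij : Function.Bijective φ := by
    rw [Fintype.bijective_iff_injective_and_card]
    refine ⟨hφ, ?_⟩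
    rw [Fintype.card_sum, Fintype.card_sum, Fintype.card_fin, Fintype.card_fin, hcardW]
    omega
  have hZA : ∀ i w, G.Adj (eZ w) (eA i) ↔ i = i₀ := by
    intro i w
    rw [hadj _ (eZ w).2, eA0]
    exact or_iff_left fun hc => (mem_rest.mp hc.1).1 (eA i).2
  have hZB : ∀ j w, ¬ G.Adj (eZ w) (eB j) := by
    intro j w
    rw [hadj _ (eZ w).2]
    rintro (hc | hc)
    · exact Finset.disjoint_left.mp h.disjoint ha (hc ▸ (eB j).2)
    · exact (mem_rest.mp hc.1).2 (eB j).2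
  refine ⟨RelIso.symm ⟨Equiv.ofBijective φ hbij, ?_⟩⟩
  rintro ((i | j) | w) ((i' | j') | w')
  · simpa [φ] using h.not_adj_left _ (eA i).2 _ (eA i').2
  · simpa [φ] using hfull _ (eA i).2 _ (eB j').2
  · simpa [φ, G.adj_comm] using hZA i w'
  · simpa [φ] using (hfull _ (eA i').2 _ (eB j).2).symm
  · simpa [φ] using h.not_adj_right _ (eB j).2 _ (eB j').2
  · simpa [φ, G.adj_comm] using hZB j w'
  · simpa [φ] using hZA i' w
  · simpa [φ] using hZB j' w
  · have : G.Adj (eZ w) (eZ w') ↔ w ≠ w' := by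
      rw [hadj _ (eZ w).2, ne_comm, ← eZ.injective.ne_iff, ← Subtype.coe_ne_coe]
      refine (or_iff_right fun hc => ?_).trans (and_iff_right (eZ w').2)
      exact (mem_rest.mp (eZ w').2).1 (hc ▸ ha)
    simpa [φ] using this

end IsCore

/-- A graph without `C_{2k+1}` and with chromatic number at least `r`, whose spectral radius is not
smaller than that of `turanIdentifyClique n r`, is isomorphic to it. -/
theorem nonempty_iso_turanIdentifyClique {k r n : ℕ}
    (hk : 2 ≤ k) (hr : 3 ≤ r) (hrk : r ≤ 2 * k) (hn : 712 * k ≤ n) (hr1 : 1 ≤ r) (hrn : r < n)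
    (hV : Fintype.card V = n) (hfree : (cycleGraph (2 * k + 1)).Free G)
    (hchi : (r : ℕ∞) ≤ G.chromaticNumber)
    (hle : (turanIdentifyClique n r hr1 hrn).adjSpectralRadius ≤ G.adjSpectralRadius) :
    Nonempty (G ≃g turanIdentifyClique n r hr1 hrn) := by
  have hne : Nonempty V := Fintype.card_pos_iff.mp (by omega)
  obtain ⟨lam, hlam0, hρ, x, hx⟩ := G.exists_isSubEigenvector
  have hchi' : ∀ N, G.Colorable N → r ≤ N := fun N hN => by
    exact_mod_cast hchi.trans hN.chromaticNumber_le
  obtain ⟨m, hm⟩ : ∃ m, m = n - r + 1 := ⟨_, rfl⟩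
  have hmR : (m : ℝ) = n - r + 1 := by
    rw [hm, Nat.cast_add, Nat.cast_sub hrn.le]
    simp
  have hkR : (2 : ℝ) ≤ k := by exact_mod_cast hk
  have hnR : 712 * (k : ℝ) ≤ n := by exact_mod_cast hn
  have hrR : (r : ℝ) ≤ 2 * k := by exact_mod_cast hrk
  have hst4 : (m : ℝ) ^ 2 - 1 ≤ 4 * ((m / 2 : ℕ) * ((m + 1) / 2 : ℕ)) := by
    obtain ⟨q, rfl | rfl⟩ := m.even_or_odd'
    · have e1 : 2 * q / 2 = q := by omega
      have e2 : (2 * q + 1) / 2 = q := by omega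
      rw [e1, e2]
      push_cast
      linarith
    · have e1 : (2 * q + 1) / 2 = q := by omega
      have e2 : (2 * q + 1 + 1) / 2 = q + 1 := by omega
      rw [e1, e2]
      push_cast
      linarith
  have hsqrt : (r : ℝ) < Real.sqrt ((m / 2 : ℕ) * ((m + 1) / 2 : ℕ)) := by
    refine Real.lt_sqrt_of_sq_lt ?_
    have e1 : 700 * (k : ℝ) ≤ m := by linarith
    have e2 : (700 * (k : ℝ)) ^ 2 ≤ m ^ 2 := pow_le_pow_left₀ (by linarith) e1 2
    have e3 : (r : ℝ) ^ 2 ≤ (2 * k) ^ 2 := pow_le_pow_left₀ (by positivity) hrR 2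
    nlinarith
  obtain ⟨l, hsl, hl⟩ := exists_sq_eq_mul_add_cliqueExcess (r := r) (by omega)
    (by omega : 0 < (m + 1) / 2) hsqrt
  have hrl : (r : ℝ) < l := hsqrt.trans_le hsl
  have hllam : l ≤ lam := by
    have h1 : ENNReal.ofReal l ≤ ENNReal.ofReal lam := by
      rw [← hρ]
      refine le_trans ?_ hle
      refine ofReal_le_adjSpectralRadius_turanIdentifyClique hrl ?_
      rw [← hm]
      exact hl
    exact (ENNReal.ofReal_le_ofReal_iff hlam0).mp h1
  have hrlam : (r : ℝ) < lam := hrl.trans_le hllam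
  have hl2 : l ^ 2 ≤ lam ^ 2 := pow_le_pow_left₀ (by linarith [r.cast_nonneg (α := ℝ)]) hllam 2
  have hst : ((m / 2 : ℕ) * ((m + 1) / 2 : ℕ) : ℝ) ≤ l ^ 2 :=
    (Real.sqrt_le_left (by linarith [r.cast_nonneg (α := ℝ)])).mp hsl
  have hlamsq : (Fintype.card V - r + 1 : ℝ) ^ 2 - 1 ≤ 4 * lam ^ 2 := by
    rw [hV, ← hmR]
    linarith
  have hlam' : (Fintype.card V - 2 * k : ℝ) / 2 ≤ lam := by
    rw [hV] at hlamsq ⊢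
    have := abs_le_of_sq_le_sq (a := (n - 2 * k : ℝ)) (b := 2 * lam) (by nlinarith) (by linarith)
    linarith [le_abs_self (n - 2 * k : ℝ)]
  obtain ⟨X, Y, hXY⟩ := hx.exists_isDensePair hk (by omega) hfree hlam'
  obtain ⟨A, B, hcore, hcard, a, ha, hadj⟩ := (hXY.isCore hfree).exists_adj_rest_iff hx hr hrk hlam0
    hlamsq hchi'
  obtain ⟨hsq, hfull⟩ := hcore.sq_le hx (by omega) hrlam hlam' hcard ha hadj
  have hsum := hcore.card_add_card_add_card
  have hκ : cliqueExcess r lam ≤ cliqueExcess r l := cliqueExcess_le (by omega) hrl hllam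
  -- Monotonicity of the excess lets both sides be compared at the same `κ = cliqueExcess r lam`:
  -- balanced value ≤ `l²` ≤ `lam²` ≤ value for `A`, `B`.
  have hcmp : (((m + 1) / 2 : ℕ) : ℝ) * (((m / 2 : ℕ) : ℝ) + cliqueExcess r lam) ≤ lam ^ 2 := by
    refine le_trans ?_ (hl.symm.le.trans hl2)
    gcongr
  obtain ⟨hsA, htB⟩ := eq_half_of_mul_add_le (m := m) (by omega) (cliqueExcess_pos (by omega) hrlam)
    (cliqueExcess_lt_one (by omega) hrlam) (hcmp.trans hsq)
  refine hcore.nonempty_iso hr1 hrn (by omega) (by omega) hcard ha hadj (hfull ?_)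
  refine le_antisymm hsq ?_
  rw [hsA, htB]
  exact hcmp

end SimpleGraph

theorem mainTheorem5 {V : Type*} [Fintype V] (k r n : ℕ)
    (hk : 2 ≤ k) (hr : 3 ≤ r) (hrk : r ≤ 2 * k) (hn : 712 * k ≤ n)
    (G : SimpleGraph V) (hV : Fintype.card V = n)
    (hfree : (SimpleGraph.cycleGraph (2 * k + 1)).Free G)
    (hchi : (r : ℕ∞) ≤ G.chromaticNumber) :
    G.adjSpectralRadius ≤
        (turanIdentifyClique n r (by omega) (by omega)).adjSpectralRadius ∧
      (G.adjSpectralRadius =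
          (turanIdentifyClique n r (by omega) (by omega)).adjSpectralRadius ↔
        Nonempty (G ≃g turanIdentifyClique n r (by omega) (by omega))) := by
  have hiso := SimpleGraph.nonempty_iso_turanIdentifyClique hk hr hrk hn (by omega) (by omega) hV
    hfree hchi
  refine ⟨?_, fun h => hiso h.ge, fun ⟨e⟩ => SimpleGraph.adjSpectralRadius_congr e⟩
  by_contra! hlt
  obtain ⟨e⟩ := hiso hlt.le
  exact hlt.ne' (SimpleGraph.adjSpectralRadius_congr e)
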